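/- Let $\mathbb{k}$ be a field of characteristic $0$. A \emph{directed simple graph} is a finite connected directed graph with at least one vertex, without directed cycles (it is drawn with all edges going from top to bottom) and with at most one edge between any two vertices; $|g|$ is its number of vertices. The graphs whose vertices are labelled bijectively by $1,\dots,n$ span the arity $n$ component of the operad $\mathrm{Lie}\text{-}\mathrm{gra}$ over $\mathbb{k}$. Its partial composite $g_1\circ_i g_2$ is the sum of all graphs obtained by inserting $g_2$ at the vertex $i$ of $g_1$ and replacing each edge between a vertex $j$ and $i$ by edges, in the same direction, between $j$ and the vertices of any non-empty subset of the vertices of $g_2$ (with the usual shift of labels); its unit is the one-vertex graph, and the symmetric groups permute the labels. A \emph{complete Lie-graph algebra} $\mathfrak g$ is a $\mathbb{Z}$-graded dg $\mathbb{k}$-module with a descending filtration $\mathfrak g_p=F_0\mathfrak g_p\supset F_1\mathfrak g_p\supset\cdots$ by submodules of each homogeneous component, preserved by the differential, such that $\mathfrak g_p\to\varprojlim_k \mathfrak g_p/F_k\mathfrak g_p$ is an isomorphism for every $p$, together with a dg algebra structure over $\mathrm{Lie}\text{-}\mathrm{gra}$ whose operations satisfy $g(F_{i_1}\mathfrak g,\dots,F_{i_n}\mathfrak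 g)\subset F_{i_1+\cdots+i_n}\mathfrak g$ for $n=|g|$. A \emph{$2$-leveled} directed simple graph is a directed simple graph each of whose vertices is placed on the bottom or on the top level (a level may be empty), all edges going from the top level to the bottom level. For $x,y\in F_1\mathfrak g_0$ write $g(x,y)$ for the action of such a graph with its bottom vertices labelled by $x$ and its top vertices labelled by $y$. With a formal symbol $\mathbb 1$, the deformation gauge group of $\mathfrak g$ is the set $\mathbb 1+F_1\mathfrak g_0=\{\mathbb 1+x : x\in F_1\mathfrak g_0\}$ with unit $\mathbb 1=\mathbb 1+0$ and product $$(\mathbb 1+x)\circledcirc(\mathbb 1+y)=\mathbb 1+\sum_{g}\frac{1}{|\mathrm{Aut}(g)|}\,g(x,y),$$ where $g$ runs over the isomorphism classes of (unlabelled) $2$-leveled directed simple graphs and $\mathrm{Aut}(g)$ is the group of permutations of the vertices that preserve the directed adjacency and the levels. \textbf{Proposition.} For every complete Lie-graph algebra $\mathfrak g$, the product $\circledcirc$ makes $\mathbb 1+F_1\mathfrak g_0$ a group with unit $\mathbb 1$, and for every $x\in F_1\mathfrak g_0$ the inverse of $\mathbb 1+x$ in this group is $$(\mathbb 1+x)^{-1}=\mathbb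 1+\sum_{g}\frac{(-1)^{|g|}}{|\mathrm{Aut}(g)|}\,g(x),$$ where $g$ runs over the isomorphism classes of (unlabelled) directed simple graphs, $\mathrm{Aut}(g)$ is the group of permutations of the vertices that preserve the directed adjacency, $g(x)$ is the action of $g$ with all vertices labelled by $x$, and the series converges for the topology of the filtration. -/

import Mathlib

noncomputable section

/-- A directed simple graph on the vertex set `V`: a connected directed graph with at least one
vertex (both part of `SimpleGraph.Connected`), directed by a global flow (no directed cycles) and
with at most one edge between two vertices. `g.Adj u v` means that there is an edge going down from
the upper vertex `u` to the lower vertex `v`. -/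
structure DsGraph (V : Type) extends Digraph V where
  acyclic : ∀ v, ¬ Relation.TransGen Adj v v
  connected : (SimpleGraph.fromRel Adj).Connected

namespace DsGraph

theorem toDigraph_injective (V : Type) :
    Function.Injective (fun g : DsGraph V => g.Adj) := by
  rintro ⟨⟨a⟩, _, _⟩ ⟨⟨b⟩, _, _⟩ h
  simp only at h
  subst h
  rfl

instance (n : ℕ) : Finite (DsGraph (Fin n)) :=
  Finite.of_injective _ (toDigraph_injective (Fin n))

/-- The map on vertices that contracts the inserted graph: if a graph with `n` vertices labelled by
`i, …, i + n - 1` replaces the vertex `i` of a graph with `m` vertices, then the labels below `i`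
are kept, those of the inserted graph are sent to `i`, and the remaining labels, which had been
shifted by `n - 1`, are shifted back. -/
def contract {m : ℕ} (n : ℕ) (i : Fin m) (u : Fin (m + n - 1)) : Fin m :=
  if h : u.1 < i.1 then ⟨u.1, by omega⟩
  else if u.1 < i.1 + n then i
  else ⟨u.1 + 1 - n, by omega⟩

/-- The position `i + j` of the vertex `j` of the inserted graph. -/
def block {m n : ℕ} (i : Fin m) (j : Fin n) : Fin (m + n - 1) :=
  ⟨i.1 + j.1, by omega⟩

/-- The graphs that occur in the partial composite `g₁ ∘ᵢ g₂`, each of them with coefficient one: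
`g₂` replaces the vertex `i` of `g₁`; there is at least one edge between a vertex `a ≠ i` of `g₁`
and the inserted graph exactly if there is one, in that direction, between `a` and `i` in `g₁`;
the edges between the other vertices are those of `g₁`. -/
def IsPartialComposite {m n : ℕ} (g₁ : DsGraph (Fin m)) (i : Fin m) (g₂ : DsGraph (Fin n))
    (h : DsGraph (Fin (m + n - 1))) : Prop :=
  (∀ u v : Fin n, h.Adj (block i u) (block i v) ↔ g₂.Adj u v) ∧
  ∀ a b : Fin m, a ≠ b →
    ((∃ u v, contract n i u = a ∧ contract n i v = b ∧ h.Adj u v) ↔ g₁.Adj a b)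

/-- The set of graphs whose sum is `g₁ ∘ᵢ g₂`. -/
def partialComp {m n : ℕ} (g₁ : DsGraph (Fin m)) (i : Fin m) (g₂ : DsGraph (Fin n)) :
    Finset (DsGraph (Fin (m + n - 1))) :=
  (Set.toFinite {h | IsPartialComposite g₁ i g₂ h}).toFinset

/-- The arguments `(x₀, …, x_{i-1}, y, x_{i+n}, …)` of the outer operation in the evaluation of a
partial composite. -/
def outerArgs {X : Type*} {m : ℕ} (n : ℕ) (i : Fin m) (x : Fin (m + n - 1) → X) (y : X)
    (a : Fin m) : X :=
  if h : a.1 < i.1 then x ⟨a.1, by omega⟩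
  else if h' : a.1 = i.1 then y
  else x ⟨a.1 + n - 1, by omega⟩

/-- Isomorphism of directed simple graphs. -/
instance isoSetoid (n : ℕ) : Setoid (DsGraph (Fin n)) where
  r g h := Nonempty (g.Adj ≃r h.Adj)
  iseqv := ⟨fun _ => ⟨RelIso.refl _⟩, fun ⟨e⟩ => ⟨e.symm⟩, fun ⟨e⟩ ⟨f⟩ => ⟨e.trans f⟩⟩

/-- The automorphism group of a directed simple graph. -/
abbrev Aut {V : Type} (g : DsGraph V) : Type := g.Adj ≃r g.Adj

end DsGraph

/-- A `k`-leveled directed simple graph: every vertex sits on one of the levels `0, …, k - 1`,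
counted from the bottom, and edges go from a level to a strictly lower one. -/
structure LeveledGraph (k : ℕ) (V : Type) extends DsGraph V where
  level : V → Fin k
  level_lt : ∀ u v, Adj u v → level v < level u

namespace LeveledGraph

theorem toPair_injective (k : ℕ) (V : Type) :
    Function.Injective (fun g : LeveledGraph k V => (g.toDsGraph, g.level)) := by
  rintro ⟨a, l, _⟩ ⟨b, l', _⟩ h
  simp only [Prod.mk.injEq] at h
  obtain ⟨rfl, rfl⟩ := h
  rfl

instance (k n : ℕ) : Finite (LeveledGraph k (Fin n)) :=
  Finite.of_injective _ (toPair_injective k (Fin n))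

/-- Isomorphism of leveled graphs: adjacency and levels are preserved. -/
instance isoSetoid (k n : ℕ) : Setoid (LeveledGraph k (Fin n)) where
  r g h := ∃ e : g.Adj ≃r h.Adj, ∀ v, h.level (e v) = g.level v
  iseqv := ⟨fun _ => ⟨RelIso.refl _, fun _ => rfl⟩,
    fun ⟨e, he⟩ => ⟨e.symm, fun v => by rw [← he (e.symm v), RelIso.apply_symm_apply]⟩,
    fun ⟨e, he⟩ ⟨f, hf⟩ => ⟨e.trans f, fun v => by rw [RelIso.trans_apply, hf, he]⟩⟩

/-- The automorphism group of a leveled graph. -/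
abbrev Aut {k : ℕ} {V : Type} (g : LeveledGraph k V) : Type :=
  {e : g.Adj ≃r g.Adj // ∀ v, g.level (e v) = g.level v}

end LeveledGraph

/-- Unlabelled directed simple graphs: isomorphism classes, sorted by the number of vertices. -/
def UnlabelledGraph : Type := Σ n : ℕ, Quotient (DsGraph.isoSetoid n)

/-- The number of vertices. -/
def UnlabelledGraph.size (g : UnlabelledGraph) : ℕ := g.1

/-- A labelled graph in the given isomorphism class. -/
def UnlabelledGraph.rep (g : UnlabelledGraph) : DsGraph (Fin g.size) := Quotient.out g.2

/-- Unlabelled `k`-leveled directed simple graphs. -/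
def UnlabelledLeveledGraph (k : ℕ) : Type := Σ n : ℕ, Quotient (LeveledGraph.isoSetoid k n)

/-- The number of vertices. -/
def UnlabelledLeveledGraph.size {k : ℕ} (g : UnlabelledLeveledGraph k) : ℕ := g.1

/-- A labelled graph in the given isomorphism class. -/
def UnlabelledLeveledGraph.rep {k : ℕ} (g : UnlabelledLeveledGraph k) :
    LeveledGraph k (Fin g.size) := Quotient.out g.2

/-- The Koszul sign of the rearrangement of `(x₀, …, xₙ₋₁)`, with degrees `p`, into
`(x_{σ 0}, …, x_{σ (n - 1)})`. -/
def koszulSign {n : ℕ} (σ : Equiv.Perm (Fin n)) (p : Fin n → ℤ) : ℤˣ :=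
  ∏ i : Fin n, ∏ j : Fin n,
    if i < j ∧ σ j < σ i then Int.negOnePow (p (σ i) * p (σ j)) else 1

/-- A complete differential graded Lie-graph algebra on `𝔤`, the direct sum of its homogeneous
components: a complete dg module (homological grading over `ℤ`) with an action of the operad of
directed simple graphs that is compatible with the differential and with the filtration. -/
structure CompleteLieGraphAlgebra (𝕜 𝔤 : Type*) [Field 𝕜] [AddCommGroup 𝔤] [Module 𝕜 𝔤] where
  /-- The component of degree `p`. -/
  deg : ℤ → Submodule 𝕜 𝔤
  isInternal : DirectSum.IsInternal deg
  /-- `filt r p` is the `r`-th filtration step of the component of degree `p`. -/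
  filt : ℕ → ℤ → Submodule 𝕜 𝔤
  filt_zero : ∀ p, filt 0 p = deg p
  filt_succ_le : ∀ r p, filt (r + 1) p ≤ filt r p
  /-- The map from `deg p` to the inverse limit of the `deg p / filt r p` is injective. -/
  separated : ∀ p x, (∀ r, x ∈ filt r p) → x = 0
  /-- The map from `deg p` to the inverse limit of the `deg p / filt r p` is surjective. -/
  complete : ∀ p (a : ℕ → 𝔤), (∀ r, a r ∈ deg p) → (∀ r, a (r + 1) - a r ∈ filt r p) →
    ∃ x ∈ deg p, ∀ r, x - a r ∈ filt r p
  /-- The differential, of degree `-1`. -/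
  d : 𝔤 →ₗ[𝕜] 𝔤
  d_mem : ∀ r p x, x ∈ filt r p → d x ∈ filt r (p - 1)
  d_d : ∀ x, d (d x) = 0
  /-- The operation of a labelled graph: the `v`-th argument is put on the vertex `v`. -/
  op : ∀ {n : ℕ}, DsGraph (Fin n) → MultilinearMap 𝕜 (fun _ : Fin n => 𝔤) 𝔤
  /-- The operations have degree `0` and preserve the filtration. -/
  op_mem : ∀ {n : ℕ} (g : DsGraph (Fin n)) (r : Fin n → ℕ) (p : Fin n → ℤ) (x : Fin n → 𝔤),
    (∀ v, x v ∈ filt (r v) (p v)) → op g x ∈ filt (∑ v, r v) (∑ v, p v)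
  /-- The operations are compatible with the differential. -/
  d_op : ∀ {n : ℕ} (g : DsGraph (Fin n)) (p : Fin n → ℤ) (x : Fin n → 𝔤),
    (∀ v, x v ∈ deg (p v)) →
    d (op g x) = ∑ v, Int.negOnePow (∑ u ∈ Finset.Iio v, p u) •
      op g (Function.update x v (d (x v)))
  /-- The one-vertex graph acts as the identity. -/
  op_unit : ∀ (g : DsGraph (Fin 1)) (x : Fin 1 → 𝔤), op g x = x 0
  /-- Equivariance: `h` is obtained from `g` by the change of labels `σ`. -/
  op_perm : ∀ {n : ℕ} (g h : DsGraph (Fin n)) (σ : g.Adj ≃r h.Adj) (p : Fin n → ℤ)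
    (x : Fin n → 𝔤), (∀ v, x v ∈ deg (p v)) →
    op h x = koszulSign σ.toEquiv p • op g (fun v => x (σ v))
  /-- Compatibility with the partial compositions. -/
  op_comp : ∀ {m n : ℕ} (g₁ : DsGraph (Fin m)) (i : Fin m) (g₂ : DsGraph (Fin n))
    (x : Fin (m + n - 1) → 𝔤),
    ∑ h ∈ DsGraph.partialComp g₁ i g₂, op h x =
      op g₁ (DsGraph.outerArgs n i x (op g₂ (fun j => x (DsGraph.block i j))))

namespace CompleteLieGraphAlgebra

variable {𝕜 𝔤 : Type*} [Field 𝕜] [AddCommGroup 𝔤] [Module 𝕜 𝔤]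

/-- The family `f` of elements of degree `0` is summable with sum `s`, for the topology of the
complete filtration. -/
def HasFilteredSum (L : CompleteLieGraphAlgebra 𝕜 𝔤) {ι : Type} (f : ι → 𝔤) (s : 𝔤) : Prop :=
  ∀ r : ℕ, ∃ S : Finset ι, ∀ T : Finset ι, S ⊆ T → s - ∑ i ∈ T, f i ∈ L.filt r 0

theorem filt_antitone (L : CompleteLieGraphAlgebra 𝕜 𝔤) (p : ℤ) :
    Antitone (fun r => L.filt r p) :=
  antitone_nat_of_succ_le fun r => L.filt_succ_le r p

theorem exists_hasFilteredSum (L : CompleteLieGraphAlgebra 𝕜 𝔤) {ι : Type} (f : ι → 𝔤)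
    (h1 : ∀ i, f i ∈ L.filt 1 0) (hf : ∀ r, {i | f i ∉ L.filt r 0}.Finite) :
    ∃ s : L.filt 1 0, L.HasFilteredSum f s := by
  classical
  have h0 : ∀ i, f i ∈ L.deg 0 := fun i => by
    rw [← L.filt_zero]; exact L.filt_succ_le 0 0 (h1 i)
  have key : ∀ r (T : Finset ι), (hf r).toFinset ⊆ T →
      ∑ i ∈ T, f i - ∑ i ∈ (hf r).toFinset, f i ∈ L.filt r 0 := by
    intro r T hT
    rw [← Finset.sum_sdiff hT, add_sub_cancel_right]
    refine Submodule.sum_mem _ fun i hi => ?_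
    simpa using (Finset.mem_sdiff.mp hi).2
  obtain ⟨s, -, hs⟩ := L.complete 0 (fun r => ∑ i ∈ (hf r).toFinset, f i)
    (fun r => Submodule.sum_mem _ fun i _ => h0 i)
    (fun r => key r _ fun i hi => by
      simp only [Set.Finite.mem_toFinset, Set.mem_ofPred_eq] at hi ⊢
      exact fun h => hi (L.filt_succ_le r 0 h))
  refine ⟨⟨s, ?_⟩, fun r => ⟨(hf r).toFinset, fun T hT => ?_⟩⟩
  · have := Submodule.add_mem _ (hs 1)
      (Submodule.sum_mem (L.filt 1 0) fun i (_ : i ∈ (hf 1).toFinset) => h1 i)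
    simpa using this
  · have := Submodule.sub_mem _ (hs r) (key r T hT)
    simpa using this

/-- The action `g(x)` of an unlabelled graph with all vertices labelled by `x`. It does not depend
on the representative if `x` has degree `0`. -/
def act (L : CompleteLieGraphAlgebra 𝕜 𝔤) (g : UnlabelledGraph) (x : 𝔤) : 𝔤 :=
  L.op g.rep (fun _ => x)

/-- The action `g(x₀, …, x_{k-1})` of an unlabelled leveled graph: the vertices on the level `l`,
counted from the bottom, are labelled by `x l`. -/
def actLeveled (L : CompleteLieGraphAlgebra 𝕜 𝔤) {k : ℕ} (g : UnlabelledLeveledGraph k)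
    (x : Fin k → 𝔤) : 𝔤 :=
  L.op g.rep.toDsGraph (fun v => x (g.rep.level v))

/-- The summands of the product `(𝟙 + x) ⊚ (𝟙 + y)`, with `x` on the bottom vertices and `y` on the
top vertices of the 2-leveled graphs. -/
def prodTerm (L : CompleteLieGraphAlgebra 𝕜 𝔤) (x y : 𝔤) (g : UnlabelledLeveledGraph 2) : 𝔤 :=
  ((Nat.card g.rep.Aut : 𝕜)⁻¹) • L.actLeveled g ![x, y]

theorem exists_prod (L : CompleteLieGraphAlgebra 𝕜 𝔤) (x y : L.filt 1 0) :
    ∃ s : L.filt 1 0, L.HasFilteredSum (L.prodTerm x y) s := by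
  have hmem : ∀ g : UnlabelledLeveledGraph 2, L.prodTerm x y g ∈ L.filt g.size 0 := by
    intro g
    have h := L.op_mem g.rep.toDsGraph (fun _ => 1) (fun _ => 0)
      (fun v => ![(x : 𝔤), (y : 𝔤)] (g.rep.level v)) (fun v => by
        generalize g.rep.level v = l
        fin_cases l
        · exact x.2
        · exact y.2)
    simp only [Finset.sum_const, Finset.card_univ, Fintype.card_fin, smul_eq_mul, mul_one,
      smul_zero] at h
    exact Submodule.smul_mem _ _ h
  have hpos : ∀ g : UnlabelledLeveledGraph 2, 1 ≤ g.size := by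
    intro g
    obtain ⟨v⟩ := g.rep.connected.nonempty
    exact v.pos
  refine L.exists_hasFilteredSum _ (fun g => L.filt_antitone 0 (hpos g) (hmem g)) fun r => ?_
  have hfin : (⋃ n ∈ Set.Iio r, Set.range
      (fun q : Quotient (LeveledGraph.isoSetoid 2 n) =>
        (⟨n, q⟩ : UnlabelledLeveledGraph 2))).Finite :=
    (Set.finite_Iio r).biUnion fun n _ => Set.finite_range _
  refine hfin.subset fun g hg => ?_
  have hlt : UnlabelledLeveledGraph.size g < r := by
    by_contra hle
    exact hg (L.filt_antitone 0 (not_lt.mp hle) (hmem g))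
  exact Set.mem_biUnion (show g.1 ∈ Set.Iio r from hlt) ⟨g.2, rfl⟩

/-- The set `𝟙 + F₁𝔤₀` of the elements `𝟙 + x`, for a formal symbol `𝟙` and `x` in the first
filtration step of the component of degree `0`. -/
@[ext]
structure GaugeElement (L : CompleteLieGraphAlgebra 𝕜 𝔤) where
  /-- The element `𝟙 + x`. -/
  onePlus ::
  /-- The element `x` of `𝟙 + x`. -/
  val : L.filt 1 0

/-- The element `𝟙 = 𝟙 + 0`. -/
def unit (L : CompleteLieGraphAlgebra 𝕜 𝔤) : L.GaugeElement := ⟨0⟩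

/-- The product `(𝟙 + x) ⊚ (𝟙 + y) = 𝟙 + ∑ g(x, y) / |Aut g|`, summed over all unlabelled 2-leveled
directed simple graphs `g`. -/
def circ (L : CompleteLieGraphAlgebra 𝕜 𝔤) (a b : L.GaugeElement) : L.GaugeElement :=
  ⟨(L.exists_prod a.val b.val).choose⟩

theorem circ_spec (L : CompleteLieGraphAlgebra 𝕜 𝔤) (a b : L.GaugeElement) :
    L.HasFilteredSum (L.prodTerm a.val b.val) (L.circ a b).val :=
  (L.exists_prod a.val b.val).choose_spec

theorem HasFilteredSum.unique {L : CompleteLieGraphAlgebra 𝕜 𝔤} {ι : Type} {f : ι → 𝔤} {s t : 𝔤}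
    (hs : L.HasFilteredSum f s) (ht : L.HasFilteredSum f t) : s = t := by
  classical
  refine sub_eq_zero.mp (L.separated 0 _ fun r => ?_)
  obtain ⟨S, hS⟩ := hs r
  obtain ⟨T, hT⟩ := ht r
  have := Submodule.sub_mem _ (hS (S ∪ T) Finset.subset_union_left)
    (hT (S ∪ T) Finset.subset_union_right)
  simpa using this

end CompleteLieGraphAlgebra

end

/-! By orbit-stabilizer, the sum of `g / |Aut g|` over the isomorphism classes with `n` vertices is
`1 / n!` times the sum over all labelled graphs on `Fin n`. Hence every series here is an
exponential generating series. It is given by a finite set `C` of colours, a relation `E` telling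
from which colour to which colour an edge may go, and a label `u a` for each colour; `HasSeries E u
s` says that it converges to `s`.

The central result is `HasSeries.comp`. Let `φ : C → Fin 2` sort the colours into two levels, such
that an edge between different levels is allowed exactly if it goes down. Substitute the series of
the two levels into all 2-leveled graphs. By the operad axioms (`opRel_comp`) the result is a sum
over coloured graphs together with a decomposition into connected blocks, each inside one level. A
coloured graph has only one such set of blocks, the components of the graph of its edges inside a
level (`IsDecomposition.card_eq`). The `n!` numberings of the blocks cancel the factor `1 / n!`, so
the product of the two series is the series of all graphs allowed by `E`.

Associativity follows since both bracketings are the series of 3-leveled graphs, with levels grouped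
as `{0, 1}, {2}` or `{0}, {1, 2}`. For the inverse, take two colours labelled by `x` and `-x`, and
let edges start only at vertices of the second colour. The first level gives `x`, as a connected
graph without edges is a point; the second gives all graphs evaluated at `-x`, which is the claimed
inverse. In their product the vertices with outgoing edges carry `-x` and the sinks carry `x` or
`-x` freely. Every graph has a sink, and recolouring it reverses the sign, so the product is `𝟙`. -/

noncomputable section

open Relation

/-! ### Operations indexed by relations on arbitrary finite vertex sets -/

/-- A relation is the adjacency relation of a directed simple graph. -/
structure IsDs {V : Type} (r : V → V → Prop) : Prop where
  acyclic : ∀ v, ¬ TransGen r v v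
  connected : (SimpleGraph.fromRel r).Connected

namespace IsDs

variable {V W : Type} {r : V → V → Prop}

/-- The directed simple graph with the given adjacency relation. -/
def graph (h : IsDs r) : DsGraph V := ⟨⟨r⟩, h.acyclic, h.connected⟩

@[simp] theorem graph_adj (h : IsDs r) : h.graph.Adj = r := rfl

theorem irrefl (h : IsDs r) (v : V) : ¬ r v v := fun hv => h.acyclic v (.single hv)

theorem comap (e : W ≃ V) (h : IsDs r) : IsDs (fun a b => r (e a) (e b)) where
  acyclic v hv := h.acyclic (e v) (TransGen.lift e (fun _ _ hab => hab) _ _ hv)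
  connected := by
    refine (SimpleGraph.Iso.connected_iff
      (⟨e, ?_⟩ : SimpleGraph.fromRel (fun a b => r (e a) (e b)) ≃g SimpleGraph.fromRel r)).mpr
      h.connected
    intro a b
    simp [SimpleGraph.fromRel_adj]

theorem comap_iff (e : W ≃ V) : IsDs (fun a b => r (e a) (e b)) ↔ IsDs r :=
  ⟨fun h => by simpa using h.comap e.symm, fun h => h.comap e⟩

end IsDs

theorem IsDs.of_unique {V : Type} [Unique V] {r : V → V → Prop} (hr : ∀ v, ¬ r v v) : IsDs r where
  acyclic v hv := by
    obtain ⟨w, h, -⟩ := TransGen.head'_iff.mp hv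
    rw [Subsingleton.elim w v] at h
    exact hr v h
  connected := by
    have : (SimpleGraph.fromRel r).Preconnected := fun u v => by
      rw [Subsingleton.elim u v]
    exact ⟨this⟩

theorem DsGraph.isDs {V : Type} (g : DsGraph V) : IsDs g.Adj := ⟨g.acyclic, g.connected⟩

theorem koszulSign_zero {n : ℕ} (σ : Equiv.Perm (Fin n)) : koszulSign σ (fun _ => 0) = 1 := by
  simp [koszulSign]

namespace CompleteLieGraphAlgebra

variable {𝕜 𝔤 : Type*} [Field 𝕜] [AddCommGroup 𝔤] [Module 𝕜 𝔤]

open scoped Classical in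
/-- The operation of a relation on `Fin n`, zero unless it is a directed simple graph. -/
def opFin (L : CompleteLieGraphAlgebra 𝕜 𝔤) {n : ℕ} (r : Fin n → Fin n → Prop) :
    MultilinearMap 𝕜 (fun _ : Fin n => 𝔤) 𝔤 :=
  if h : IsDs r then L.op h.graph else 0

/-- The operation of a relation on a finite set, zero unless it is a directed simple graph. -/
def opRel (L : CompleteLieGraphAlgebra 𝕜 𝔤) {V : Type} [Finite V] (r : V → V → Prop) :
    MultilinearMap 𝕜 (fun _ : V => 𝔤) 𝔤 :=
  (L.opFin fun a b => r ((Finite.equivFin V).symm a) ((Finite.equivFin V).symm b)).domDomCongr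
    (Finite.equivFin V).symm

variable (L : CompleteLieGraphAlgebra 𝕜 𝔤)

/-- In degree `0` all Koszul signs are `1`. This makes `opRel` independent of the numbering of the
vertices. -/
theorem opFin_perm {n : ℕ} (r : Fin n → Fin n → Prop) (e : Equiv.Perm (Fin n)) (x : Fin n → 𝔤)
    (hx : ∀ v, x v ∈ L.filt 0 0) :
    L.opFin r x = L.opFin (fun a b => r (e a) (e b)) (fun v => x (e v)) := by
  by_cases h : IsDs r
  · rw [opFin, opFin, dif_pos h, dif_pos (h.comap e)]
    have := L.op_perm (h.comap e).graph h.graph ⟨e, Iff.rfl⟩ (fun _ => 0) x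
      (fun v => by rw [← L.filt_zero]; exact hx v)
    rw [this, koszulSign_zero, one_smul]
    rfl
  · rw [opFin, opFin, dif_neg h, dif_neg (fun h' => h ((IsDs.comap_iff e).mp h'))]
    rfl

theorem opFin_equiv {m n : ℕ} (r : Fin n → Fin n → Prop) (e : Fin m ≃ Fin n) (x : Fin n → 𝔤)
    (hx : ∀ v, x v ∈ L.filt 0 0) :
    L.opFin r x = L.opFin (fun a b => r (e a) (e b)) (fun v => x (e v)) := by
  obtain rfl : m = n := by simpa using Fintype.card_congr e
  exact L.opFin_perm r e x hx

variable {V W : Type} [Finite V] [Finite W]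

theorem opRel_equiv (e : W ≃ V) (r : V → V → Prop) (x : V → 𝔤) (hx : ∀ v, x v ∈ L.filt 0 0) :
    L.opRel r x = L.opRel (fun a b => r (e a) (e b)) (fun v => x (e v)) := by
  simp only [opRel, MultilinearMap.domDomCongr_apply]
  rw [L.opFin_equiv _ ((Finite.equivFin W).symm.trans (e.trans (Finite.equivFin V)))
    _ (fun v => hx _)]
  simp

theorem opRel_fin {n : ℕ} (r : Fin n → Fin n → Prop) (x : Fin n → 𝔤)
    (hx : ∀ v, x v ∈ L.filt 0 0) : L.opRel r x = L.opFin r x := by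
  simp only [opRel, MultilinearMap.domDomCongr_apply]
  rw [L.opFin_equiv r (Finite.equivFin (Fin n)).symm x hx]

theorem opRel_eq_zero {r : V → V → Prop} (h : ¬ IsDs r) : L.opRel r = 0 := by
  ext x
  rw [opRel, opFin, dif_neg (fun h' => h ((IsDs.comap_iff _).mp h'))]
  rfl

theorem opRel_fin_of_isDs {n : ℕ} {r : Fin n → Fin n → Prop} (h : IsDs r) (x : Fin n → 𝔤)
    (hx : ∀ v, x v ∈ L.filt 0 0) : L.opRel r x = L.op h.graph x := by
  rw [L.opRel_fin r x hx, opFin, dif_pos h]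

theorem opRel_adj {n : ℕ} (g : DsGraph (Fin n)) (x : Fin n → 𝔤)
    (hx : ∀ v, x v ∈ L.filt 0 0) : L.opRel g.Adj x = L.op g x :=
  L.opRel_fin_of_isDs g.isDs x hx

theorem opFin_mem {n : ℕ} (r : Fin n → Fin n → Prop) (w : Fin n → ℕ) (x : Fin n → 𝔤)
    (hx : ∀ v, x v ∈ L.filt (w v) 0) : L.opFin r x ∈ L.filt (∑ v, w v) 0 := by
  by_cases h : IsDs r
  · rw [opFin, dif_pos h]
    simpa using L.op_mem h.graph w (fun _ => 0) x hx
  · rw [opFin, dif_neg h]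
    exact Submodule.zero_mem _

theorem opRel_mem [Fintype V] (r : V → V → Prop) (w : V → ℕ) (x : V → 𝔤)
    (hx : ∀ v, x v ∈ L.filt (w v) 0) : L.opRel r x ∈ L.filt (∑ v, w v) 0 := by
  rw [← Equiv.sum_comp (Finite.equivFin V).symm]
  exact L.opFin_mem _ _ _ fun v => hx _

theorem filt_le {r s : ℕ} (h : r ≤ s) (p : ℤ) : L.filt s p ≤ L.filt r p := L.filt_antitone p h

theorem mem_filt_zero {r : ℕ} {p : ℤ} {x : 𝔤} (h : x ∈ L.filt r p) : x ∈ L.filt 0 p :=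
  L.filt_le (Nat.zero_le r) p h

theorem opRel_mem_zero (r : V → V → Prop) (x : V → 𝔤)
    (hx : ∀ v, x v ∈ L.filt 0 0) : L.opRel r x ∈ L.filt 0 0 := by
  have := Fintype.ofFinite V
  simpa using L.opRel_mem r (fun _ => 0) x hx

theorem opRel_mem_card [Fintype V] (r : V → V → Prop) (x : V → 𝔤)
    (hx : ∀ v, x v ∈ L.filt 1 0) : L.opRel r x ∈ L.filt (Fintype.card V) 0 := by
  simpa using L.opRel_mem r (fun _ => 1) x hx

theorem opRel_unique [Unique V] {r : V → V → Prop} (hr : ∀ v, ¬ r v v) (x : V → 𝔤)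
    (hx : ∀ v, x v ∈ L.filt 0 0) : L.opRel r x = x default := by
  rw [L.opRel_equiv (Equiv.ofUnique (Fin 1) V) r x hx,
    L.opRel_fin_of_isDs (IsDs.of_unique fun v => hr _) _ fun v => hx _, L.op_unit]
  exact congrArg x (Subsingleton.elim _ _)

end CompleteLieGraphAlgebra

/-! ### Contraction of relations along maps -/

section Push

variable {V W B : Type}

/-- The contraction of a relation along a map, with the loops removed. -/
def push (f : V → B) (r : V → V → Prop) (a b : B) : Prop :=
  a ≠ b ∧ ∃ u v, f u = a ∧ f v = b ∧ r u v

/-- The restriction of a relation to a fibre. -/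
def onFiber (f : V → B) (r : V → V → Prop) (b : B) (u v : {v // f v = b}) : Prop := r u v

theorem push_of {f : V → B} {r : V → V → Prop} {u v : V} (hf : f u ≠ f v) (h : r u v) :
    push f r (f u) (f v) := ⟨hf, u, v, rfl, rfl, h⟩

theorem push_push (q : V → W) (f : W → B) (r : V → V → Prop) :
    push f (push q r) = push (fun v => f (q v)) r := by
  ext a b
  constructor
  · rintro ⟨hab, s, t, rfl, rfl, -, u, v, rfl, rfl, h⟩
    exact ⟨hab, u, v, rfl, rfl, h⟩
  · rintro ⟨hab, u, v, rfl, rfl, h⟩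
    exact ⟨hab, q u, q v, rfl, rfl, fun h' => hab (congrArg f h'), u, v, rfl, rfl, h⟩

/-- A directed path either stays inside one fibre or projects to a nonempty directed path of the
contraction, because a step inside a fibre projects to a constant. -/
theorem acyclic_of_push {f : V → B} {r : V → V → Prop} (hB : ∀ a, ¬ TransGen (push f r) a a)
    (hf : ∀ b v, ¬ TransGen (onFiber f r b) v v) (v : V) : ¬ TransGen r v v := by
  have key : ∀ u v, TransGen r u v → TransGen (push f r) (f u) (f v) ∨
      ∃ h : f v = f u, TransGen (onFiber f r (f u)) ⟨u, rfl⟩ ⟨v, h⟩ := by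
    intro u v h
    induction h with
    | @single v h =>
      by_cases hv : f v = f u
      · exact .inr ⟨hv, .single h⟩
      · exact .inl (.single (push_of (Ne.symm hv) h))
    | @tail v w _ h ih =>
      by_cases hv : f w = f v
      · rcases ih with ih | ⟨h', ih⟩
        · exact .inl (by rwa [hv])
        · exact .inr ⟨hv.trans h', ih.tail h⟩
      · have := push_of (Ne.symm hv) h
        rcases ih with ih | ⟨h', ih⟩
        · exact .inl (ih.tail this)
        · exact .inl (.single (by rwa [h'] at this))
  intro h
  rcases key v v h with h | ⟨_, h⟩
  · exact hB _ h
  · exact hf _ _ h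

theorem connected_push {f : V → B} (hf : Function.Surjective f) {r : V → V → Prop}
    (h : (SimpleGraph.fromRel r).Connected) : (SimpleGraph.fromRel (push f r)).Connected := by
  have key : ∀ u v, (SimpleGraph.fromRel r).Reachable u v →
      (SimpleGraph.fromRel (push f r)).Reachable (f u) (f v) := by
    intro u v huv
    rw [SimpleGraph.reachable_iff_reflTransGen] at huv
    induction huv with
    | refl => rfl
    | @tail v w _ h ih =>
      by_cases hv : f v = f w
      · rwa [← hv]
      · refine ih.trans (SimpleGraph.Adj.reachable ?_)
        rw [SimpleGraph.fromRel_adj] at h ⊢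
        exact ⟨hv, h.2.imp (push_of hv) (push_of (Ne.symm hv))⟩
  have : Nonempty B := h.nonempty.map f
  refine ⟨fun a b => ?_⟩
  obtain ⟨u, rfl⟩ := hf a
  obtain ⟨v, rfl⟩ := hf b
  exact key u v (h.preconnected u v)

open scoped Classical in
/-- The map that collapses a subset to a point. -/
def collapse (p : V → Prop) (v : V) : Option {v // ¬ p v} :=
  if h : p v then none else some ⟨v, h⟩

theorem collapse_pos {p : V → Prop} {v : V} (h : p v) : collapse p v = none := dif_pos h

theorem collapse_neg {p : V → Prop} {v : V} (h : ¬ p v) : collapse p v = some ⟨v, h⟩ := dif_neg h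

theorem collapse_surjective {p : V → Prop} (h : ∃ v, p v) : Function.Surjective (collapse p) := by
  rintro (_ | v)
  · obtain ⟨v, hv⟩ := h
    exact ⟨v, collapse_pos hv⟩
  · exact ⟨v, collapse_neg v.2⟩

end Push

/-! ### Insertion of one graph, without reference to labels -/

namespace CompleteLieGraphAlgebra

variable {𝕜 𝔤 : Type*} [Field 𝕜] [AddCommGroup 𝔤] [Module 𝕜 𝔤]
variable (L : CompleteLieGraphAlgebra 𝕜 𝔤)

open scoped Classical in
/-- The composition with one inserted graph. -/
theorem opRel_collapse {V : Type} [Fintype V] (p : V → Prop)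
    {s : Option {v // ¬ p v} → Option {v // ¬ p v} → Prop} (hs : IsDs s) {K : V → V → Prop}
    (hK : IsDs fun u v : {v // p v} => K u v) (x : V → 𝔤) (hx : ∀ v, x v ∈ L.filt 0 0) :
    L.opRel s (fun o => o.elim (L.opRel (fun u v : {v // p v} => K u v) fun v => x v)
      fun v => x v) =
    ∑ r : V → V → Prop, if push (collapse p) r = s ∧ ∀ u v, p u → p v → (r u v ↔ K u v)
      then L.opRel r x else 0 := by
  obtain ⟨m, ⟨eN⟩⟩ := Finite.exists_equiv_fin {v // ¬ p v}
  obtain ⟨n, ⟨eW⟩⟩ := Finite.exists_equiv_fin {v // p v}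
  -- The collapsed point gets the last label, so the insertion shifts no other label.
  let i : Fin (m + 1) := Fin.last m
  let eB : Option {v // ¬ p v} ≃ Fin (m + 1) := (Equiv.optionCongr eN).trans finSuccEquivLast.symm
  let eV : V ≃ Fin (m + 1 + n - 1) := (Equiv.sumCompl p).symm.trans <|
    (Equiv.sumComm _ _).trans <| (Equiv.sumCongr eN eW).trans <| finSumFinEquiv.trans <|
      finCongr (by omega)
  have eB_none : eB none = i := by simp [eB, i]
  have eB_some : ∀ v, eB (some v) = (eN v).castSucc := fun v => by simp [eB]
  have eV_pos : ∀ v : {v // p v}, eV v = DsGraph.block i (eW v) := fun v => by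
    ext; simp [eV, i, DsGraph.block]
  have eV_neg : ∀ v : {v // ¬ p v}, (eV v).1 = (eN v).1 := fun v => by
    simp [eV]
  have hcon : ∀ v, DsGraph.contract n i (eV v) = eB (collapse p v) := by
    intro v
    by_cases h : p v
    · rw [collapse_pos h, eB_none, eV_pos ⟨v, h⟩]
      simp [DsGraph.contract, DsGraph.block]
    · rw [collapse_neg h, eB_some]
      ext
      have := eV_neg ⟨v, h⟩
      simp [DsGraph.contract, this, i]
  have hg₁ := hs.comap eB.symm
  have hg₂ := hK.comap eW.symm
  let X : Fin (m + 1 + n - 1) → 𝔤 := fun a => x (eV.symm a)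
  have hX : ∀ a, X a ∈ L.filt 0 0 := fun a => hx _
  have hinner : L.opRel (fun u v : {v // p v} => K u v) (fun v => x v) =
      L.op hg₂.graph (fun j => X (DsGraph.block i j)) := by
    rw [L.opRel_equiv eW.symm _ _ fun v => hx _, L.opRel_fin_of_isDs hg₂ _ fun v => hx _]
    congr 1
    ext j
    have := eV_pos (eW.symm j)
    rw [Equiv.apply_symm_apply] at this
    simp [X, ← this]
  set y := L.opRel (fun u v : {v // p v} => K u v) (fun v => x v) with hy
  have hy0 : y ∈ L.filt 0 0 := L.opRel_mem_zero _ _ fun v => hx _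
  have hargs : ∀ o : Option {v // ¬ p v}, o.elim y (fun v => x v) ∈ L.filt 0 0 := by
    rintro (_ | v)
    · exact hy0
    · exact hx _
  have houter : L.opRel s (fun o => o.elim y fun v => x v) =
      L.op hg₁.graph (DsGraph.outerArgs n i X (L.op hg₂.graph
        (fun j => X (DsGraph.block i j)))) := by
    rw [L.opRel_equiv eB.symm _ _ hargs, L.opRel_fin_of_isDs hg₁ _ fun v => hargs _, ← hinner]
    congr 1
    ext a
    obtain ⟨o, rfl⟩ := eB.surjective a
    rw [Equiv.symm_apply_apply]
    rcases o with _ | v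
    · simp [eB_none, DsGraph.outerArgs, i]
    · have h1 : (⟨(eN v).1, by omega⟩ : Fin (m + 1 + n - 1)) = eV v := Fin.ext (eV_neg v).symm
      simp [eB_some, DsGraph.outerArgs, i, h1, X]
  rw [houter, ← L.op_comp, ← Finset.sum_filter]
  -- Transport along `eV` embeds the graphs of the partial composite into the relations on `V`
  -- satisfying the condition. The relations that are missed are not directed simple graphs, and
  -- `opRel` vanishes on them.
  refine Finset.sum_of_injOn (fun h u v => h.Adj (eV u) (eV v)) ?_ ?_ ?_ ?_
  · intro g _ h _ hgh
    refine DsGraph.toDigraph_injective _ ?_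
    funext a b
    simpa using congrFun (congrFun hgh (eV.symm a)) (eV.symm b)
  · intro h hh
    simp only [DsGraph.partialComp, Set.Finite.coe_toFinset] at hh
    obtain ⟨h1, h2⟩ := hh
    simp only [Finset.coe_filter, Finset.mem_univ, true_and, Set.mem_ofPred_eq]
    refine ⟨?_, fun u v hu hv => ?_⟩
    · ext a b
      by_cases hab : a = b
      · subst hab
        simp [push, hs.irrefl]
      · have := h2 (eB a) (eB b) (by simpa using hab)
        simp only [IsDs.graph_adj, Equiv.symm_apply_apply] at this
        rw [← this]
        simp only [push, ne_eq, hab, not_false_eq_true, true_and]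
        constructor
        · rintro ⟨u, v, rfl, rfl, h⟩
          exact ⟨_, _, hcon u, hcon v, h⟩
        · rintro ⟨u, v, h3, h4, h⟩
          refine ⟨eV.symm u, eV.symm v, eB.injective ?_, eB.injective ?_, by simpa using h⟩
          · rw [← hcon, Equiv.apply_symm_apply, h3]
          · rw [← hcon, Equiv.apply_symm_apply, h4]
    · have := h1 (eW ⟨u, hu⟩) (eW ⟨v, hv⟩)
      rw [← eV_pos, ← eV_pos] at this
      simpa using this
  · intro r hr hr'
    by_cases hds : IsDs r
    · refine absurd ?_ hr'
      obtain ⟨h1, h2⟩ := (Finset.mem_filter.mp hr).2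
      refine ⟨(hds.comap eV.symm).graph, ?_, by simp⟩
      simp only [DsGraph.partialComp, Set.Finite.coe_toFinset]
      refine ⟨fun u v => ?_, fun a b hab => ?_⟩
      · have hu := eV_pos (eW.symm u)
        have hv := eV_pos (eW.symm v)
        rw [Equiv.apply_symm_apply] at hu hv
        rw [← hu, ← hv]
        simpa using h2 _ _ (eW.symm u).2 (eW.symm v).2
      · subst h1
        simp only [IsDs.graph_adj, push]
        have : eB.symm a ≠ eB.symm b := by simpa using hab
        simp only [ne_eq, this, not_false_eq_true, true_and]
        constructor
        · rintro ⟨u, v, h3, h4, h⟩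
          refine ⟨eV.symm u, eV.symm v, eB.injective ?_, eB.injective ?_, by simpa using h⟩
          · rw [← hcon, Equiv.apply_symm_apply, h3, Equiv.apply_symm_apply]
          · rw [← hcon, Equiv.apply_symm_apply, h4, Equiv.apply_symm_apply]
        · rintro ⟨u, v, h3, h4, h⟩
          refine ⟨eV u, eV v, ?_, ?_, by simpa using h⟩
          · rw [hcon, h3, Equiv.apply_symm_apply]
          · rw [hcon, h4, Equiv.apply_symm_apply]
    · rw [L.opRel_eq_zero hds]
      rfl
  · intro h _
    have := L.opRel_equiv eV.symm (fun u v => h.Adj (eV u) (eV v)) x hx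
    simp only [Equiv.apply_symm_apply] at this
    rw [this]
    exact (L.opRel_adj h X hX).symm

end CompleteLieGraphAlgebra

/-! ### Simultaneous insertion in all vertices -/

namespace CompleteLieGraphAlgebra

variable {𝕜 𝔤 : Type*} [Field 𝕜] [AddCommGroup 𝔤] [Module 𝕜 𝔤]
variable (L : CompleteLieGraphAlgebra 𝕜 𝔤)

-- The start of the induction: all fibres are points, which act as the identity, and the only
-- relation that contributes is the pullback of `g`.
open scoped Classical in
theorem opRel_comp_of_injective {V B : Type} [Fintype V] [Finite B] {f : V → B}
    (hf : Function.Injective f) {g : B → B → Prop} (hg : IsDs g) {K : V → V → Prop}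
    (hK : ∀ b, IsDs (onFiber f K b)) (x : V → 𝔤) (hx : ∀ v, x v ∈ L.filt 0 0) :
    L.opRel g (fun b => L.opRel (onFiber f K b) fun v => x v) =
    ∑ r : V → V → Prop, if push f r = g ∧ ∀ u v, f u = f v → (r u v ↔ K u v)
      then L.opRel r x else 0 := by
  have hsurj : Function.Surjective f := fun b => by
    obtain ⟨v⟩ := (hK b).connected.nonempty
    exact ⟨v, v.2⟩
  have hKirr : ∀ v, ¬ K v v := fun v => (hK (f v)).irrefl ⟨v, rfl⟩
  have hpt : ∀ v, L.opRel (onFiber f K (f v)) (fun w => x w) = x v := by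
    intro v
    have : Unique {w // f w = f v} := ⟨⟨⟨v, rfl⟩⟩, fun w => Subtype.ext (hf w.2)⟩
    rw [L.opRel_unique (fun w => (hK _).irrefl w) _ fun w => hx _]
    exact congrArg x (hf (default : {w // f w = f v}).2)
  obtain ⟨e, rfl⟩ : ∃ e : V ≃ B, e = f := ⟨Equiv.ofBijective f ⟨hf, hsurj⟩, rfl⟩
  rw [L.opRel_equiv e g _ fun b => L.opRel_mem_zero _ _ fun v => hx _]
  simp only [hpt]
  rw [Finset.sum_eq_single (fun u v => g (e u) (e v)), if_pos]
  · refine ⟨?_, fun u v huv => ?_⟩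
    · ext a b
      constructor
      · rintro ⟨-, u, v, rfl, rfl, h⟩
        exact h
      · intro h
        obtain ⟨u, rfl⟩ := hsurj a
        obtain ⟨v, rfl⟩ := hsurj b
        exact push_of (fun h' => hg.irrefl _ (by rwa [h'] at h)) h
    · rw [hf huv]
      exact iff_of_false (hg.irrefl _) (hKirr _)
  · intro r _ hr
    rw [if_neg]
    rintro ⟨rfl, h⟩
    refine hr ?_
    ext u v
    by_cases huv : u = v
    · subst huv
      simp [h u u rfl, hKirr, push]
    · constructor
      · exact fun h => push_of (hf.ne huv) h
      · rintro ⟨-, u', v', h1, h2, h⟩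
        rwa [hf h1, hf h2] at h
  · simp

-- Induction on the number of vertices. A fibre with at least two points is collapsed, so that `f`
-- factors as `f' ∘ collapse p`; the induction hypothesis handles `f'`, and `opRel_collapse`
-- reinserts the fibre.
open scoped Classical in
theorem opRel_comp_aux (N : ℕ) : ∀ {V B : Type} [Fintype V] [Finite B] (_ : Fintype.card V = N)
    (f : V → B) {g : B → B → Prop} (_ : IsDs g) {K : V → V → Prop}
    (_ : ∀ b, IsDs (onFiber f K b)) (x : V → 𝔤) (_ : ∀ v, x v ∈ L.filt 0 0),
    L.opRel g (fun b => L.opRel (onFiber f K b) fun v => x v) =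
    ∑ r : V → V → Prop, if push f r = g ∧ ∀ u v, f u = f v → (r u v ↔ K u v)
      then L.opRel r x else 0 := by
  induction N using Nat.strong_induction_on with
  | _ N ih =>
  intro V B _ _ hN f g hg K hK x hx
  by_cases hf : Function.Injective f
  · exact L.opRel_comp_of_injective hf hg hK x hx
  obtain ⟨u₀, v₀, huv, hne⟩ : ∃ u v, f u = f v ∧ u ≠ v := by
    simpa [Function.Injective] using hf
  have hKirr : ∀ v, ¬ K v v := fun v => (hK (f v)).irrefl ⟨v, rfl⟩
  let p : V → Prop := fun v => f v = f u₀
  let f' : Option {v // ¬ p v} → B := fun o => o.elim (f u₀) fun v => f v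
  have hf' : ∀ v, f' (collapse p v) = f v := fun v => by
    by_cases h : p v
    · rw [collapse_pos h]; exact h.symm
    · rw [collapse_neg h]; rfl
  have hcard : Fintype.card (Option {v // ¬ p v}) < N := by
    rw [← hN]
    refine Fintype.card_lt_of_surjective_not_injective (collapse p)
      (collapse_surjective ⟨u₀, rfl⟩) fun h => hne (h ?_)
    exact (collapse_pos (p := p) rfl).trans (collapse_pos (p := p) huv.symm).symm
  let K' := push (collapse p) K
  let y := L.opRel (onFiber f K (f u₀)) fun v => x v
  let x' : Option {v // ¬ p v} → 𝔤 := fun o => o.elim y fun v => x v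
  have hx' : ∀ o, x' o ∈ L.filt 0 0 := by
    rintro (_ | v)
    · exact L.opRel_mem_zero _ _ fun v => hx _
    · exact hx _
  have hpush : ∀ (r : V → V → Prop) (u v : V) (hu : ¬ p u) (hv : ¬ p v),
      push (collapse p) r (some ⟨u, hu⟩) (some ⟨v, hv⟩) ↔ u ≠ v ∧ r u v := by
    intro r u v hu hv
    rw [← collapse_neg hu, ← collapse_neg hv]
    have hinj : ∀ w z : V, ¬ p z → collapse p w = collapse p z → w = z := by
      intro w z hz h
      rw [collapse_neg hz] at h
      by_cases hw : p w
      · simp [collapse_pos hw] at h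
      · simpa [collapse_neg hw] using h
    constructor
    · rintro ⟨h, w, z, h1, h2, h3⟩
      rw [hinj _ _ hu h1, hinj _ _ hv h2] at h3
      exact ⟨fun h' => h (by rw [h']), h3⟩
    · rintro ⟨h1, h2⟩
      exact push_of (fun h' => h1 (hinj _ _ hv h')) h2
  have hnone : ∀ o : Option {v // ¬ p v}, f' o = f u₀ → o = none := by
    rintro (_ | v) h
    · rfl
    · exact absurd h v.2
  have hfib : ∀ b, IsDs (onFiber f' K' b) ∧
      L.opRel (onFiber f K b) (fun v => x v) = L.opRel (onFiber f' K' b) (fun o => x' o) := by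
    intro b
    -- The fibre of `f'` over `f u₀` is the collapsed point, which carries the value `y` of the
    -- original fibre. All other fibres are unchanged.
    by_cases hb : b = f u₀
    · subst hb
      have : Unique {o // f' o = f u₀} := ⟨⟨⟨none, rfl⟩⟩, fun o => Subtype.ext (hnone _ o.2)⟩
      have hirr : ∀ o, ¬ onFiber f' K' (f u₀) o o := fun o h => h.1 rfl
      refine ⟨IsDs.of_unique hirr, ?_⟩
      rw [L.opRel_unique hirr _ fun o => hx' _]
      have : (default : {o // f' o = f u₀}).1 = none := hnone _ (default : {o // f' o = f u₀}).2
      rw [this]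
      rfl
    · have hp : ∀ v : {v // f v = b}, ¬ p v := fun v h => hb (v.2.symm.trans h)
      let e : {v // f v = b} ≃ {o // f' o = b} := Equiv.ofBijective
        (fun v => ⟨some ⟨v, hp v⟩, v.2⟩) <| by
          constructor
          · intro u v h
            simpa [Subtype.ext_iff] using h
          · rintro ⟨_ | v, h⟩
            · exact absurd h.symm hb
            · exact ⟨⟨v, h⟩, rfl⟩
      have he : (fun u v => onFiber f' K' b (e u) (e v)) = onFiber f K b := by
        ext u v
        refine (hpush K u v (hp u) (hp v)).trans ⟨fun h => h.2, fun h => ⟨fun h' => ?_, h⟩⟩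
        rw [onFiber, h'] at h
        exact hKirr _ h
      refine ⟨(IsDs.comap_iff e).mp (by rw [he]; exact hK b), ?_⟩
      rw [L.opRel_equiv e (onFiber f' K' b) _ fun o => hx' _, he]
      rfl
  simp only [(hfib _).2]
  rw [ih _ hcard rfl f' hg (fun b => (hfib b).1) x' hx']
  have hterm : ∀ s : Option {v // ¬ p v} → Option {v // ¬ p v} → Prop,
      (if push f' s = g ∧ ∀ a b, f' a = f' b → (s a b ↔ K' a b) then L.opRel s x' else 0) =
      ∑ r : V → V → Prop, if push (collapse p) r = s then
        if (push f' s = g ∧ ∀ a b, f' a = f' b → (s a b ↔ K' a b)) ∧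
          (∀ u v, p u → p v → (r u v ↔ K u v)) then L.opRel r x else 0 else 0 := by
    intro s
    by_cases hs : push f' s = g ∧ ∀ a b, f' a = f' b → (s a b ↔ K' a b)
    · by_cases hds : IsDs s
      · rw [if_pos hs]
        simp only [and_iff_right hs, ← ite_and]
        exact L.opRel_collapse p hds (hK (f u₀)) x hx
      · rw [L.opRel_eq_zero hds]
        simp only [zero_apply, ite_self]
        refine (Finset.sum_eq_zero fun r _ => ?_).symm
        split_ifs with h1 h2
        · rw [L.opRel_eq_zero, zero_apply]
          -- If `r` were a directed simple graph, then so would be its contraction `s`: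
          -- connectedness descends from `r`, and acyclicity lifts from `g` and the fibres of `f'`.
          refine fun hr => hds ⟨acyclic_of_push (f := f') ?_ ?_, ?_⟩
          · rw [hs.1]; exact hg.acyclic
          · intro b
            have : onFiber f' s b = onFiber f' K' b := by
              ext u v; exact hs.2 _ _ (u.2.trans v.2.symm)
            rw [this]
            exact (hfib b).1.acyclic
          · rw [← h1]
            exact connected_push (collapse_surjective (p := p) ⟨u₀, rfl⟩) hr.connected
        · rfl
        · rfl
    · simp [hs]
  simp only [hterm]
  rw [Finset.sum_comm]
  refine Finset.sum_congr rfl fun r _ => ?_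
  -- The intermediate graph `s` is determined by `r`, so only one summand survives.
  refine (Finset.sum_eq_single (push (collapse p) r) (fun s _ hs => if_neg (Ne.symm hs))
    (fun h => absurd (@Finset.mem_univ _ (_) _) h)).trans ?_
  rw [if_pos rfl]
  by_cases hr : IsDs r
  swap
  · simp [L.opRel_eq_zero hr]
  refine if_congr ?_ rfl rfl
  rw [push_push, and_assoc]
  simp only [hf']
  refine and_congr_right fun _ => ⟨fun ⟨h1, h2⟩ u v huv => ?_, fun h => ⟨fun a b hab => ?_, ?_⟩⟩
  · by_cases hu : p u
    · exact h2 u v hu (huv.symm.trans hu)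
    · have hv : ¬ p v := fun hv => hu (huv.trans hv)
      have := h1 (some ⟨u, hu⟩) (some ⟨v, hv⟩) huv
      rw [hpush] at this
      replace this := this.trans (hpush K u v hu hv)
      by_cases h : u = v
      · subst h
        exact iff_of_false (hr.irrefl _) (hKirr _)
      · simpa [h] using this
  · rcases a with _ | u
    · rw [hnone b hab.symm]
      exact iff_of_false (fun h => h.1 rfl) (fun h => h.1 rfl)
    · rcases b with _ | v
      · exact absurd hab u.2
      · exact (hpush r u v u.2 v.2).trans ((and_congr_right fun _ => h u v hab).trans
          (hpush K u v u.2 v.2).symm)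
  · exact fun u v hu hv => h u v (hu.trans hv.symm)

open scoped Classical in
/-- The simultaneous composition along a map `f`: the sum runs over the relations that restrict to
`K` on the fibres of `f` and whose contraction is `g`. -/
theorem opRel_comp {V B : Type} [Fintype V] [Finite B] (f : V → B) {g : B → B → Prop}
    (hg : IsDs g) {K : V → V → Prop} (hK : ∀ b, IsDs (onFiber f K b)) (x : V → 𝔤)
    (hx : ∀ v, x v ∈ L.filt 0 0) :
    L.opRel g (fun b => L.opRel (onFiber f K b) fun v => x v) =
    ∑ r : V → V → Prop, if push f r = g ∧ ∀ u v, f u = f v → (r u v ↔ K u v)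
      then L.opRel r x else 0 :=
  L.opRel_comp_aux _ rfl f hg hK x hx

end CompleteLieGraphAlgebra

/-! ### Sums over coloured graphs -/

namespace CompleteLieGraphAlgebra

variable {𝕜 𝔤 : Type*} [Field 𝕜] [AddCommGroup 𝔤] [Module 𝕜 𝔤]
variable (L : CompleteLieGraphAlgebra 𝕜 𝔤)

theorem ite_congr_of_iff {α : Type*} {p q : Prop} {_ : Decidable p} {_ : Decidable q} {a b : α}
    (h : p ↔ q) : ite p a b = ite q a b := by
  simp [h]

/-- Multilinear expansion. The indices need only be in bijection with the families of choices, so a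
colouring of every fibre can be indexed by one colouring of the total set. -/
theorem opRel_sum {B : Type} [Finite B] (g : B → B → Prop) {α : B → Type} {ι : Type}
    {fι : Fintype ι} (φ : ι → ∀ b, α b) (hφ : Function.Bijective φ) (G : ∀ b, α b → 𝔤) (x : B → 𝔤)
    (hx : ∀ b, ∃ _ : Fintype (α b), x b = ∑ a, G b a) :
    L.opRel g x = ∑ s : ι, L.opRel g fun b => G b (φ s b) := by
  classical
  have := Fintype.ofFinite B
  choose i hi using hx
  rw [funext hi, MultilinearMap.map_sum]
  exact (Fintype.sum_bijective φ hφ _ _ fun s => rfl).symm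

/-- Continuity of the operations: after expanding `x = y + (x - y)`, every term except the one with
`y` everywhere has an argument in the `R`-th filtration step. -/
theorem opRel_sub_mem {V : Type} [Fintype V] (r : V → V → Prop) (R : ℕ) (x y : V → 𝔤)
    (hy : ∀ v, y v ∈ L.filt 0 0) (h : ∀ v, x v - y v ∈ L.filt R 0) :
    L.opRel r x - L.opRel r y ∈ L.filt R 0 := by
  classical
  have hxy : x = y + (x - y) := by abel
  rw [hxy, MultilinearMap.map_add_univ, ← Finset.sum_erase_add _ _ (Finset.mem_univ Finset.univ),
    Finset.piecewise_univ, add_sub_cancel_right]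
  refine Submodule.sum_mem _ fun s hs => ?_
  obtain ⟨v, hv⟩ : ∃ v, v ∉ s := by
    simpa [Finset.eq_univ_iff_forall] using hs
  refine L.filt_le ?_ 0 (L.opRel_mem r (fun w => if w ∈ s then 0 else R) _ fun w => ?_)
  · refine le_trans ?_ (Finset.single_le_sum (fun w _ => Nat.zero_le _) (Finset.mem_univ v))
    simp [hv]
  · by_cases hw : w ∈ s
    · simpa [hw] using hy w
    · simpa [hw] using h w

variable {C : Type} [Fintype C]

open scoped Classical in
/-- The operation of a directed simple graph with vertices coloured by `c`, zero unless all edges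
are allowed by `E`. -/
def opColored (E : C → C → Prop) {V : Type} [Finite V] (c : V → C) (r : V → V → Prop)
    (x : V → 𝔤) : 𝔤 :=
  if ∀ a b, r a b → E (c a) (c b) then L.opRel r x else 0

open scoped Classical in
/-- The sum of the operations of all directed simple graphs with vertices coloured by `c` and edges
allowed by `E`. -/
def sumColored (E : C → C → Prop) {V : Type} [Fintype V] (c : V → C) (x : V → 𝔤) : 𝔤 :=
  ∑ r : V → V → Prop, L.opColored E c r x

open scoped Classical in
/-- The sum of the operations of all directed simple graphs on `V` whose vertices are coloured by
`C`, with edges allowed by `E`, where the vertices of colour `a` are labelled by `u a`. -/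
def coeff (E : C → C → Prop) (u : C → 𝔤) (V : Type) [Fintype V] : 𝔤 :=
  ∑ c : V → C, L.sumColored E c fun v => u (c v)

theorem coeff_equiv (E : C → C → Prop) (u : C → 𝔤) (hu : ∀ a, u a ∈ L.filt 0 0) {V W : Type}
    {_ : Fintype V} {_ : Fintype W} (e : V ≃ W) : L.coeff E u V = L.coeff E u W := by
  classical
  refine (Fintype.sum_equiv (Equiv.arrowCongr e.symm (Equiv.refl C)) _ _ fun c => ?_).symm
  refine Fintype.sum_equiv (Equiv.arrowCongr e.symm (Equiv.arrowCongr e.symm (Equiv.refl Prop)))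
    _ _ fun r => ?_
  rw [opColored, L.opRel_equiv e r _ fun v => hu _]
  refine ite_congr_of_iff ?_
  simp [e.forall_congr_left]

theorem coeff_mem (E : C → C → Prop) (u : C → 𝔤) (hu : ∀ a, u a ∈ L.filt 1 0) (V : Type)
    [Fintype V] : L.coeff E u V ∈ L.filt (Fintype.card V) 0 := by
  refine Submodule.sum_mem _ fun c _ => Submodule.sum_mem _ fun r _ => ?_
  rw [opColored]
  split_ifs
  · exact L.opRel_mem_card r _ fun v => hu _
  · exact Submodule.zero_mem _

open scoped Classical in
theorem opRel_comp_family {V B : Type} [Fintype V] [Finite B] (f : V → B) {g : B → B → Prop}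
    (hg : IsDs g) (k : ∀ b, {v // f v = b} → {v // f v = b} → Prop) (hk : ∀ b, IsDs (k b))
    (x : V → 𝔤) (hx : ∀ v, x v ∈ L.filt 0 0) :
    L.opRel g (fun b => L.opRel (k b) fun v => x v) =
    ∑ r : V → V → Prop, if onFiber f r = k ∧ push f r = g then L.opRel r x else 0 := by
  obtain ⟨K, hK⟩ : ∃ K, onFiber f K = k := by
    -- The relations on the fibres are glued to one on `V` without edges between different fibres.
    refine ⟨fun u v => ∃ h : f v = f u, k (f u) ⟨u, rfl⟩ ⟨v, h⟩, ?_⟩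
    ext b ⟨u, hu⟩ ⟨v, hv⟩
    subst hu
    exact ⟨fun ⟨_, h⟩ => h, fun h => ⟨hv, h⟩⟩
  have := L.opRel_comp f hg (K := K) (fun b => by rw [hK]; exact hk b) x hx
  rw [hK] at this
  rw [this]
  refine Finset.sum_congr rfl fun r _ => ite_congr_of_iff ?_
  rw [and_comm]
  refine and_congr_left fun _ => ⟨fun h => ?_, fun h u v huv => ?_⟩
  · rw [← hK]
    ext b u v
    exact h u v (u.2.trans v.2.symm)
  · rw [← hK] at h
    have := congrFun (congrFun (congrFun h (f u)) ⟨u, rfl⟩) ⟨v, huv.symm⟩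
    exact iff_of_eq this

-- Expanding each argument chooses colours and a graph on every fibre. The colours glue to a
-- colouring of `V`, and the composition sums over the ways to join the graphs by edges contracting
-- to `g`.
open scoped Classical in
theorem opRel_coeff {V B : Type} [Fintype V] [Finite B] (E : C → C → Prop)
    (u : B → C → 𝔤) (hu : ∀ b a, u b a ∈ L.filt 0 0) (f : V → B) {g : B → B → Prop}
    (hg : IsDs g) :
    L.opRel g (fun b => L.coeff E (u b) {v // f v = b}) =
    ∑ c : V → C, ∑ r : V → V → Prop,
      if (∀ b, IsDs (onFiber f r b)) ∧ (∀ a b, f a = f b → r a b → E (c a) (c b)) ∧ push f r = g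
      then L.opRel r (fun v => u (f v) (c v)) else 0 := by
  have hbij : Function.Bijective fun (c : V → C) b (v : {v // f v = b}) => c v := by
    constructor
    · intro c c' h
      funext v
      exact congrFun (congrFun h (f v)) ⟨v, rfl⟩
    · intro c
      refine ⟨fun v => c (f v) ⟨v, rfl⟩, ?_⟩
      funext b ⟨v, hv⟩
      subst hv
      rfl
  rw [L.opRel_sum g _ hbij
    (fun b c => L.sumColored E c fun v => u b (c v))
    (fun b => L.coeff E (u b) {v // f v = b}) fun b => ⟨_, rfl⟩]
  refine Finset.sum_congr rfl fun c _ => ?_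
  rw [L.opRel_sum g (fι := Fintype.ofFinite _) id Function.bijective_id
    (fun b r => L.opColored E (fun v : {v // f v = b} => c v) r fun v => u b (c v))
    (fun b => L.sumColored E (fun v : {v // f v = b} => c v) fun v => u b (c v))
    fun b => ⟨_, rfl⟩]
  have hterm : ∀ k : ∀ b, {v // f v = b} → {v // f v = b} → Prop,
      L.opRel g (fun b => L.opColored E (fun v : {v // f v = b} => c v) (k b) fun v => u b (c v)) =
      ∑ r : V → V → Prop, if onFiber f r = k then
        if (∀ b, IsDs (k b)) ∧ (∀ b v w, k b v w → E (c v) (c w)) ∧ push f r = g then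
          L.opRel r (fun v => u (f v) (c v)) else 0 else 0 := by
    intro k
    by_cases h1 : ∀ b, IsDs (k b)
    · by_cases h2 : ∀ b v w, k b v w → E (c v) (c w)
      · simp only [and_iff_right h1, and_iff_right h2, ← ite_and]
        refine Eq.trans ?_ (L.opRel_comp_family f hg k h1 (fun v => u (f v) (c v))
          fun v => hu _ _)
        congr 1
        funext b
        rw [opColored, if_pos (h2 b)]
        congr 1
        funext v
        rw [v.2]
      · simp only [h2, false_and, and_false, if_false, ite_self, Finset.sum_const_zero]
        obtain ⟨b, hb⟩ := not_forall.mp h2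
        exact (L.opRel g).map_coord_zero b (if_neg hb)
    · simp only [h1, false_and, if_false, ite_self, Finset.sum_const_zero]
      obtain ⟨b, hb⟩ := not_forall.mp h1
      refine (L.opRel g).map_coord_zero b ?_
      simp only [opColored, L.opRel_eq_zero hb, zero_apply, ite_self]
  simp only [id_eq, hterm]
  rw [Finset.sum_comm]
  refine Finset.sum_congr rfl fun r _ => ?_
  refine (Finset.sum_eq_single (onFiber f r) (fun s _ hs => if_neg (Ne.symm hs))
    (fun h => absurd (@Finset.mem_univ _ (_) _) h)).trans ?_
  rw [if_pos rfl]
  refine ite_congr_of_iff (and_congr_right fun _ => and_congr_left fun _ => ?_)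
  exact ⟨fun h a b hab hr => h (f b) ⟨a, hab⟩ ⟨b, rfl⟩ hr,
    fun h b v w hvw => h v w (v.2.trans w.2.symm) hvw⟩

end CompleteLieGraphAlgebra

/-! ### Counting fibre sizes and decompositions -/

/-- The number of maps with prescribed sizes of the fibres. -/
theorem card_fiber_sizes_mul_prod_factorial {V : Type} [Fintype V] [DecidableEq V] {n : ℕ}
    (m : Fin n → ℕ) :
    (Finset.univ.filter fun f : V → Fin n =>
      ∀ b, Fintype.card {v // f v = b} = m b).card * ∏ b, (m b).factorial =
    if Fintype.card V = ∑ b, m b then (Fintype.card V).factorial else 0 := by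
  classical
  -- Double counting: a bijection from `V` to the disjoint union of the `Fin (m b)` is a map `f`
  -- with a numbering of each of its fibres.
  let Φ : (Σ f : V → Fin n, ∀ b, {v // f v = b} ≃ Fin (m b)) → (V ≃ Σ b, Fin (m b)) :=
    fun p => (Equiv.sigmaFiberEquiv p.1).symm.trans (Equiv.sigmaCongrRight p.2)
  have hΦ : Function.Bijective Φ := by
    constructor
    · rintro ⟨f, ψ⟩ ⟨f', ψ'⟩ h
      have hf : f = f' := by
        funext v
        exact congrArg Sigma.fst (DFunLike.congr_fun h v)
      subst hf
      congr 1
      funext b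
      ext ⟨v, hv⟩ : 1
      subst hv
      exact eq_of_heq (Sigma.mk.inj_iff.mp (DFunLike.congr_fun h v)).2
    · intro e
      refine ⟨⟨fun v => (e v).1, fun b => (e.subtypeEquiv fun v => Iff.rfl).trans
        (Equiv.sigmaSubtype b)⟩, ?_⟩
      ext v <;> rfl
  have hcard : ∀ {α β : Type} [Fintype α] [Fintype β] [DecidableEq α] [DecidableEq β],
      Fintype.card (α ≃ β) =
        if Fintype.card α = Fintype.card β then (Fintype.card β).factorial else 0 := by
    intro α β _ _ _ _
    split_ifs with h
    · rw [Fintype.card_equiv (Fintype.equivOfCardEq h), h]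
    · refine Fintype.card_eq_zero_iff.mpr ⟨fun e => h (Fintype.card_congr e)⟩
  have h1 := Fintype.card_of_bijective hΦ
  rw [Fintype.card_sigma, hcard, Fintype.card_sigma] at h1
  simp only [Fintype.card_pi, hcard, Fintype.card_fin] at h1
  rw [Finset.card_filter, Finset.sum_mul]
  refine Eq.trans (Finset.sum_congr rfl fun f _ => ?_) (h1.trans ?_)
  · split_ifs with h
    · simp [h]
    · obtain ⟨b, hb⟩ := not_forall.mp h
      rw [zero_mul, Finset.prod_eq_zero (Finset.mem_univ b) (if_neg hb)]
  · split_ifs with h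
    · rw [h]
    · rfl

/-- The data of a contraction `f` of a coloured graph `r` whose fibres are directed simple graphs
with edges allowed by `E`, and of a two-leveled structure `l` on the contracted graph which is
compatible with the colours. -/
structure IsDecomposition {C V B : Type} (E : C → C → Prop) (φ : C → Fin 2) (c : V → C)
    (r : V → V → Prop) (f : V → B) (l : B → Fin 2) : Prop where
  fiber : ∀ b, IsDs (onFiber f r b)
  edge : ∀ a b, f a = f b → r a b → E (c a) (c b)
  isDs : IsDs (push f r)
  level : ∀ a b, push f r a b → l a > l b
  color : ∀ v, φ (c v) = l (f v)

namespace IsDecomposition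

variable {C V B : Type} {E : C → C → Prop} {φ : C → Fin 2} {c : V → C} {r : V → V → Prop}
  {f : V → B} {l : B → Fin 2}

/-- The graph of the edges between vertices on the same level. -/
def monoGraph (φ : C → Fin 2) (c : V → C) (r : V → V → Prop) : SimpleGraph V :=
  SimpleGraph.fromRel fun a b => r a b ∧ φ (c a) = φ (c b)

theorem color_eq_of_reachable {u v : V} (h : (monoGraph φ c r).Reachable u v) :
    φ (c u) = φ (c v) := by
  rw [SimpleGraph.reachable_iff_reflTransGen] at h
  induction h with
  | refl => rfl
  | tail _ h ih =>
    refine ih.trans ?_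
    rw [monoGraph, SimpleGraph.fromRel_adj] at h
    exact h.2.elim (fun h => h.2) fun h => h.2.symm

theorem surjective (h : IsDecomposition E φ c r f l) : Function.Surjective f := fun b => by
  obtain ⟨v⟩ := (h.fiber b).connected.nonempty
  exact ⟨v, v.2⟩

/-- Fibres are connected and lie in one level. Conversely, an edge between distinct blocks strictly
lowers the level, so an edge inside a level stays in its block. -/
theorem map_eq_iff (h : IsDecomposition E φ c r f l) (u v : V) :
    f u = f v ↔ (monoGraph φ c r).Reachable u v := by
  constructor
  · intro huv
    refine ((h.fiber (f v)).connected.preconnected ⟨u, huv⟩ ⟨v, rfl⟩).map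
      (⟨Subtype.val, ?_⟩ : SimpleGraph.fromRel (onFiber f r (f v)) →g monoGraph φ c r)
    intro a b hab
    rw [SimpleGraph.fromRel_adj] at hab
    have hc : φ (c a) = φ (c b) := by rw [h.color, h.color, a.2, b.2]
    rw [monoGraph, SimpleGraph.fromRel_adj]
    exact ⟨fun h' => hab.1 (Subtype.ext h'), hab.2.imp (fun h' => ⟨h', hc⟩) fun h' => ⟨h', hc.symm⟩⟩
  · intro huv
    have key : ∀ a b, r a b → φ (c a) = φ (c b) → f a = f b := by
      intro a b hab hc
      by_contra hne
      have := h.level _ _ (push_of hne hab)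
      rw [← h.color, ← h.color, hc] at this
      exact lt_irrefl _ this
    rw [SimpleGraph.reachable_iff_reflTransGen] at huv
    induction huv with
    | refl => rfl
    | tail _ h ih =>
      refine ih.trans ?_
      rw [monoGraph, SimpleGraph.fromRel_adj] at h
      exact h.2.elim (fun h => key _ _ h.1 h.2) fun h => (key _ _ h.1 h.2).symm

theorem adj (hE : ∀ a b, φ a ≠ φ b → (E a b ↔ φ a > φ b)) (h : IsDecomposition E φ c r f l)
    (u v : V) (huv : r u v) : E (c u) (c v) := by
  by_cases hf : f u = f v
  · exact h.edge u v hf huv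
  · have := h.level _ _ (push_of hf huv)
    rw [← h.color, ← h.color] at this
    exact (hE _ _ this.ne').mpr this

/-- The components do form a decomposition: contracted edges strictly lower the level, which
excludes directed cycles. -/
theorem of_reachable (hE : ∀ a b, φ a ≠ φ b → (E a b ↔ φ a > φ b)) (hr : IsDs r)
    (hrE : ∀ u v, r u v → E (c u) (c v)) (hf : Function.Surjective f)
    (hfr : ∀ u v, f u = f v ↔ (monoGraph φ c r).Reachable u v)
    (hl : ∀ v, φ (c v) = l (f v)) : IsDecomposition E φ c r f l := by
  have level : ∀ a b, push f r a b → l a > l b := by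
    rintro _ _ ⟨hne, u, v, rfl, rfl, huv⟩
    have : φ (c u) ≠ φ (c v) := by
      intro h
      refine hne ((hfr u v).mpr (SimpleGraph.Adj.reachable ?_))
      rw [monoGraph, SimpleGraph.fromRel_adj]
      exact ⟨fun h' => hne (congrArg f h'), .inl ⟨huv, h⟩⟩
    rw [← hl, ← hl]
    exact (hE _ _ this).mp (hrE u v huv)
  refine ⟨fun b => ?_, fun a b _ h => hrE a b h, ⟨fun b hb => ?_, connected_push hf hr.connected⟩,
    level, hl⟩
  · refine ⟨fun v hv => hr.acyclic v (hv.lift Subtype.val (fun _ _ h => h)), ?_⟩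
    obtain ⟨v, rfl⟩ := hf b
    have : Nonempty {w // f w = f v} := ⟨⟨v, rfl⟩⟩
    refine ⟨fun u w => ?_⟩
    have key : ∀ a, (monoGraph φ c r).Reachable u.1 a → ∃ h : f a = f v,
        (SimpleGraph.fromRel (onFiber f r (f v))).Reachable u ⟨a, h⟩ := by
      intro a ha
      rw [SimpleGraph.reachable_iff_reflTransGen] at ha
      induction ha with
      | refl => exact ⟨u.2, SimpleGraph.Reachable.refl _⟩
      | @tail a b _ hab ih =>
        obtain ⟨h, ih⟩ := ih
        have hb : f b = f v := ((hfr a b).mpr hab.reachable).symm.trans h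
        refine ⟨hb, ih.trans (SimpleGraph.Adj.reachable ?_)⟩
        rw [monoGraph, SimpleGraph.fromRel_adj] at hab
        rw [SimpleGraph.fromRel_adj]
        exact ⟨fun h' => hab.1 (congrArg Subtype.val h'), hab.2.imp (fun h => h.1) fun h => h.1⟩
    exact (key w ((hfr _ _).mp (u.2.trans w.2.symm))).2
  · have key : ∀ a b, TransGen (push f r) a b → l a > l b := by
      intro a b h
      induction h with
      | single h => exact level _ _ h
      | tail _ h ih => exact (level _ _ h).trans ih
    exact lt_irrefl _ (key b b hb)

open scoped Classical in
/-- The decompositions of a coloured graph are unique up to the names of the blocks. -/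
theorem card_eq [Fintype V] (hE : ∀ a b, φ a ≠ φ b → (E a b ↔ φ a > φ b)) (hr : IsDs r)
    (hrE : ∀ u v, r u v → E (c u) (c v)) : ∃ q ≤ Fintype.card V, ∀ n,
    Nat.card {p : (V → Fin n) × (Fin n → Fin 2) // IsDecomposition E φ c r p.1 p.2} =
      if n = q then n.factorial else 0 := by
  let M := monoGraph φ c r
  let Q := M.ConnectedComponent
  have hout : ∀ v, φ (c (M.connectedComponentMk v).out) = φ (c v) := fun v =>
    color_eq_of_reachable (SimpleGraph.ConnectedComponent.eq.mp (Quot.out_eq _))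
  refine ⟨Fintype.card Q, Fintype.card_le_of_surjective M.connectedComponentMk
    Quot.mk_surjective, fun n => ?_⟩
  -- Here `q` is the number of components, and the decompositions are the numberings of the
  -- components. The level of a block is read off at any representative.
  let Ψ : (Q ≃ Fin n) →
      {p : (V → Fin n) × (Fin n → Fin 2) // IsDecomposition E φ c r p.1 p.2} := fun e =>
    ⟨(fun v => e (M.connectedComponentMk v), fun j => φ (c (e.symm j).out)),
      of_reachable hE hr hrE (e.surjective.comp Quot.mk_surjective)
        (fun u v => e.apply_eq_iff_eq.trans SimpleGraph.ConnectedComponent.eq)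
        (fun v => by simp [hout])⟩
  have hΨ : Function.Bijective Ψ := by
    constructor
    · intro e e' h
      ext x : 1
      obtain ⟨v, rfl⟩ := Quot.mk_surjective x
      exact congrFun (congrArg (fun p => p.1.1) h) v
    · rintro ⟨⟨f, l⟩, h⟩
      have hfr := h.map_eq_iff
      let g : Q → Fin n := Quot.lift f fun u v huv => (hfr u v).mpr huv
      have hg : Function.Bijective g := by
        constructor
        · rintro ⟨u⟩ ⟨v⟩ huv
          exact SimpleGraph.ConnectedComponent.eq.mpr ((hfr u v).mp huv)
        · intro b
          obtain ⟨v, rfl⟩ := h.surjective b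
          exact ⟨M.connectedComponentMk v, rfl⟩
      refine ⟨Equiv.ofBijective g hg, Subtype.ext (Prod.ext rfl ?_)⟩
      funext b
      obtain ⟨v, rfl⟩ := h.surjective b
      have : (Equiv.ofBijective g hg).symm (f v) = M.connectedComponentMk v := by
        rw [Equiv.symm_apply_eq]
        rfl
      change φ (c ((Equiv.ofBijective g hg).symm (f v)).out) = l (f v)
      rw [this, hout, h.color]
  rw [← Nat.card_congr (Equiv.ofBijective Ψ hΨ), Nat.card_eq_fintype_card]
  split_ifs with h
  · rw [Fintype.card_equiv (Fintype.equivOfCardEq (by simp [h])), h]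
  · exact Fintype.card_eq_zero_iff.mpr ⟨fun e => h (by simpa using (Fintype.card_congr e).symm)⟩

end IsDecomposition

/-! ### Exponential series and their composition -/

namespace CompleteLieGraphAlgebra

variable {𝕜 𝔤 : Type*} [Field 𝕜] [AddCommGroup 𝔤] [Module 𝕜 𝔤]
variable (L : CompleteLieGraphAlgebra 𝕜 𝔤)
variable {C : Type} [Fintype C]

/-- The sum over the coloured graphs with less than `R` vertices, weighted by the inverse orders of
the automorphism groups. -/
def partialSum (E : C → C → Prop) (u : C → 𝔤) (R : ℕ) : 𝔤 :=
  ∑ N ∈ Finset.range R, ((N.factorial : 𝕜)⁻¹) • L.coeff E u (Fin N)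

/-- The sum of the series over all directed simple graphs coloured by `C` with edges allowed by
`E` is `s`. -/
def HasSeries (E : C → C → Prop) (u : C → 𝔤) (s : 𝔤) : Prop :=
  ∀ R, s - L.partialSum E u R ∈ L.filt R 0

variable {L} in
theorem HasSeries.unique {E : C → C → Prop} {u : C → 𝔤} {s t : 𝔤} (hs : L.HasSeries E u s)
    (ht : L.HasSeries E u t) : s = t := by
  refine sub_eq_zero.mp (L.separated 0 _ fun r => ?_)
  simpa using Submodule.sub_mem _ (hs r) (ht r)

open scoped Classical in
/-- The evaluation of `g` at the series with the coefficients `L.coeff E (U b)`: the part of it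
that belongs to the set of vertices `V`. -/
def sumMaps (E : C → C → Prop) {B : Type} [Fintype B] (g : B → B → Prop) (U : B → C → 𝔤)
    (V : Type) [Fintype V] : 𝔤 :=
  ∑ f : V → B, L.opRel g fun b => L.coeff E (U b) {v // f v = b}

/-- The exponential formula: `N! / ∏ (m b)!` maps have fibre sizes `m`, so the weight `1 / N!`
becomes the product of the weights `1 / (m b)!` of the arguments. The bound `R` only makes the range
of `m` finite. -/
theorem sumMaps_eq (E : C → C → Prop) {n : ℕ} (g : Fin n → Fin n → Prop) (U : Fin n → C → 𝔤)
    (hU : ∀ b a, U b a ∈ L.filt 0 0) (V : Type) [Fintype V] [CharZero 𝕜] {R : ℕ}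
    (hR : Fintype.card V < R) :
    (((Fintype.card V).factorial : 𝕜)⁻¹) • L.sumMaps E g U V =
    ∑ m ∈ Fintype.piFinset fun _ : Fin n => Finset.range R,
      if Fintype.card V = ∑ b, m b then
        (∏ b, ((m b).factorial : 𝕜)⁻¹) • L.opRel g fun b => L.coeff E (U b) (Fin (m b)) else 0 := by
  classical
  have h1 : L.sumMaps E g U V = ∑ m ∈ Fintype.piFinset fun _ : Fin n => Finset.range R,
      (Finset.univ.filter fun f : V → Fin n =>
        ∀ b, Fintype.card {v // f v = b} = m b).card •
        L.opRel g fun b => L.coeff E (U b) (Fin (m b)) := by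
    rw [sumMaps, ← Finset.sum_fiberwise_of_maps_to (t := Fintype.piFinset fun _ : Fin n =>
      Finset.range R) (g := fun f b => Fintype.card {v // f v = b})]
    · refine Finset.sum_congr rfl fun m _ => ?_
      rw [← Finset.sum_const]
      refine Finset.sum_congr (Finset.filter_congr fun f _ => funext_iff) fun f hf => ?_
      have hf' := (Finset.mem_filter.mp hf).2
      congr 1
      funext b
      exact L.coeff_equiv E (U b) (hU b) (Fintype.equivFinOfCardEq (hf' b))
    · intro f _
      simp only [Fintype.mem_piFinset, Finset.mem_range]
      exact fun b => (Fintype.card_subtype_le _).trans_lt hR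
  rw [h1, Finset.smul_sum]
  refine Finset.sum_congr rfl fun m _ => ?_
  have h2 := card_fiber_sizes_mul_prod_factorial (V := V) m
  rw [← Nat.cast_smul_eq_nsmul 𝕜, smul_smul]
  have h3 : ∏ b, ((m b).factorial : 𝕜) ≠ 0 :=
    Finset.prod_ne_zero_iff.mpr fun b _ => Nat.cast_ne_zero.mpr (Nat.factorial_ne_zero _)
  have h4 : ((Fintype.card V).factorial : 𝕜) ≠ 0 := Nat.cast_ne_zero.mpr (Nat.factorial_ne_zero _)
  have h5 := congrArg (Nat.cast : ℕ → 𝕜) h2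
  push_cast at h5
  split_ifs with h
  · rw [if_pos h] at h5
    congr 1
    rw [Finset.prod_inv_distrib]
    field_simp
    exact h5
  · rw [if_neg h] at h5
    rw [(mul_eq_zero.mp h5).resolve_right h3, mul_zero, zero_smul]

/-- By continuity the arguments may be truncated. In the expansion, the terms of total size at least
`R` lie in the `R`-th filtration step, and the others are those of `sumMaps`. -/
theorem opRel_sub_sumMaps_mem [CharZero 𝕜] (E : C → C → Prop) {n : ℕ} (g : Fin n → Fin n → Prop)
    (U : Fin n → C → 𝔤) (hU : ∀ b a, U b a ∈ L.filt 1 0) (s : Fin n → 𝔤)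
    (hs : ∀ b, L.HasSeries E (U b) (s b)) (R : ℕ) :
    L.opRel g s - ∑ N ∈ Finset.range R, ((N.factorial : 𝕜)⁻¹) • L.sumMaps E g U (Fin N) ∈
      L.filt R 0 := by
  have hmem : ∀ b m, L.coeff E (U b) (Fin m) ∈ L.filt m 0 := fun b m => by
    simpa using L.coeff_mem E (U b) (hU b) (Fin m)
  have h1 := L.opRel_sub_mem g R s (fun b => L.partialSum E (U b) R)
    (fun b => Submodule.sum_mem _ fun m _ =>
      Submodule.smul_mem _ _ (L.mem_filt_zero (hmem b m))) fun b => hs b R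
  suffices h2 : L.opRel g (fun b => L.partialSum E (U b) R) -
      ∑ N ∈ Finset.range R, ((N.factorial : 𝕜)⁻¹) • L.sumMaps E g U (Fin N) ∈ L.filt R 0 by
    simpa using Submodule.add_mem _ h1 h2
  have h3 : ∑ N ∈ Finset.range R, ((N.factorial : 𝕜)⁻¹) • L.sumMaps E g U (Fin N) =
      ∑ m ∈ Fintype.piFinset fun _ : Fin n => Finset.range R, if ∑ b, m b ∈ Finset.range R then
        (∏ b, ((m b).factorial : 𝕜)⁻¹) • L.opRel g fun b => L.coeff E (U b) (Fin (m b)) else 0 := by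
    refine Eq.trans ?_ (Finset.sum_congr rfl fun m _ => Finset.sum_ite_eq' (Finset.range R)
      (∑ b, m b) fun _ => (∏ b, ((m b).factorial : 𝕜)⁻¹) • L.opRel g fun b =>
        L.coeff E (U b) (Fin (m b)))
    rw [Finset.sum_comm]
    refine Finset.sum_congr rfl fun N hN => ?_
    have := L.sumMaps_eq E g U (fun b a => L.mem_filt_zero (hU b a)) (Fin N) (R := R)
      (by simpa using hN)
    simpa using this
  have h4 : L.opRel g (fun b => L.partialSum E (U b) R) =
      ∑ m ∈ Fintype.piFinset fun _ : Fin n => Finset.range R,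
        (∏ b, ((m b).factorial : 𝕜)⁻¹) • L.opRel g fun b => L.coeff E (U b) (Fin (m b)) := by
    simp only [partialSum]
    rw [MultilinearMap.map_sum_finset]
    refine Finset.sum_congr rfl fun m _ => ?_
    rw [MultilinearMap.map_smul_univ]
  rw [h3, h4, ← Finset.sum_sub_distrib]
  refine Submodule.sum_mem _ fun m _ => ?_
  split_ifs with h
  · simp
  · rw [sub_zero]
    refine Submodule.smul_mem _ _ (L.filt_le (not_lt.mp ((Finset.mem_range).not.mp h)) 0 ?_)
    exact L.opRel_mem g m _ fun b => hmem b _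

open scoped Classical in
/-- The sum of `L.sumMaps` over all two-leveled graphs on `B`. -/
def sumLevels (E : C → C → Prop) (φ : C → Fin 2) (u : C → 𝔤) (B V : Type) [Fintype V]
    [Fintype B] : 𝔤 :=
  ∑ l : B → Fin 2, ∑ g : B → B → Prop, if ∀ a b, g a b → l a > l b then
    L.sumMaps E g (fun b a => if φ a = l b then u a else 0) V else 0

open scoped Classical in
/-- The sum over all coloured graphs on `V` together with a decomposition along a map to `B`. -/
def sumDecompositions (E : C → C → Prop) (φ : C → Fin 2) (u : C → 𝔤) (B V : Type) [Fintype V]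
    [Fintype B] : 𝔤 :=
  ∑ c : V → C, ∑ r : V → V → Prop,
    Nat.card {p : (V → B) × (B → Fin 2) // IsDecomposition E φ c r p.1 p.2} •
      L.opRel r fun v => u (c v)

-- Labelling by zero the colours outside the level of a block keeps only the colourings compatible
-- with `l`. The sum over `g` disappears because `g` must be `push f r`.
open scoped Classical in
theorem sumLevels_eq_sumDecompositions (E : C → C → Prop) (φ : C → Fin 2) (u : C → 𝔤)
    (hu : ∀ a, u a ∈ L.filt 0 0) (B V : Type) [Fintype V] [Fintype B] :
    L.sumLevels E φ u B V = L.sumDecompositions E φ u B V := by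
  rw [sumLevels, sumDecompositions]
  have hU : ∀ (l : B → Fin 2) b a, (if φ a = l b then u a else 0) ∈ L.filt 0 0 := by
    intro l b a
    split_ifs
    · exact hu a
    · exact Submodule.zero_mem _
  have hop : ∀ (l : B → Fin 2) (f : V → B) (c : V → C) (r : V → V → Prop),
      L.opRel r (fun v => if φ (c v) = l (f v) then u (c v) else 0) =
        if ∀ v, φ (c v) = l (f v) then L.opRel r fun v => u (c v) else 0 := by
    intro l f c r
    split_ifs with h
    · simp [h]
    · obtain ⟨v, hv⟩ := not_forall.mp h
      exact (L.opRel r).map_coord_zero v (if_neg hv)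
  have h1 : ∀ (l : B → Fin 2) (g : B → B → Prop), (if ∀ a b, g a b → l a > l b then
      L.sumMaps E g (fun b a => if φ a = l b then u a else 0) V else 0) =
      ∑ f : V → B, ∑ c : V → C, ∑ r : V → V → Prop,
        if push f r = g then if IsDecomposition E φ c r f l then
          L.opRel r fun v => u (c v) else 0 else 0 := by
    intro l g
    by_cases hl : ∀ a b, g a b → l a > l b
    · rw [if_pos hl, sumMaps]
      refine Finset.sum_congr rfl fun f _ => ?_
      by_cases hg : IsDs g
      · rw [L.opRel_coeff E _ (hU l) f hg]
        refine Finset.sum_congr rfl fun c _ => Finset.sum_congr rfl fun r _ => ?_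
        rw [hop, ← ite_and, ← ite_and]
        refine ite_congr_of_iff ⟨fun h => ?_, fun h => ?_⟩
        · obtain ⟨⟨h1, h2, rfl⟩, h3⟩ := h
          exact ⟨rfl, h1, h2, hg, hl, h3⟩
        · exact ⟨⟨h.2.fiber, h.2.edge, h.1⟩, h.2.color⟩
      · rw [L.opRel_eq_zero hg, zero_apply]
        refine (Finset.sum_eq_zero fun c _ => Finset.sum_eq_zero fun r _ => ?_).symm
        rw [← ite_and, if_neg]
        rintro ⟨rfl, h⟩
        exact hg h.isDs
    · rw [if_neg hl]
      refine (Finset.sum_eq_zero fun f _ => Finset.sum_eq_zero fun c _ =>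
        Finset.sum_eq_zero fun r _ => ?_).symm
      rw [← ite_and, if_neg]
      rintro ⟨rfl, h⟩
      exact hl h.level
  simp only [h1]
  have h2 : ∀ l : B → Fin 2, (∑ g : B → B → Prop, ∑ f : V → B, ∑ c : V → C, ∑ r : V → V → Prop,
      if push f r = g then if IsDecomposition E φ c r f l then
        L.opRel r fun v => u (c v) else 0 else 0) =
      ∑ f : V → B, ∑ c : V → C, ∑ r : V → V → Prop,
        if IsDecomposition E φ c r f l then L.opRel r fun v => u (c v) else 0 := by
    intro l
    rw [Finset.sum_comm]
    refine Finset.sum_congr rfl fun f _ => ?_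
    rw [Finset.sum_comm]
    refine Finset.sum_congr rfl fun c _ => ?_
    rw [Finset.sum_comm]
    refine Finset.sum_congr rfl fun r _ => ?_
    rw [Finset.sum_ite_eq, if_pos (Finset.mem_univ _)]
  simp only [h2]
  have h3 : ∀ (c : V → C) (r : V → V → Prop),
      Nat.card {p : (V → B) × (B → Fin 2) // IsDecomposition E φ c r p.1 p.2} •
        L.opRel r (fun v => u (c v)) = ∑ l : B → Fin 2, ∑ f : V → B,
        if IsDecomposition E φ c r f l then L.opRel r fun v => u (c v) else 0 := by
    intro c r
    rw [Nat.card_eq_fintype_card, Fintype.card_subtype, ← Finset.sum_const, Finset.sum_filter,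
      Fintype.sum_prod_type,
      Finset.sum_comm]
  simp only [h3]
  have h4 : ∀ l : B → Fin 2, (∑ f : V → B, ∑ c : V → C, ∑ r : V → V → Prop,
      if IsDecomposition E φ c r f l then L.opRel r fun v => u (c v) else 0) =
      ∑ c : V → C, ∑ r : V → V → Prop, ∑ f : V → B,
        if IsDecomposition E φ c r f l then L.opRel r fun v => u (c v) else 0 := fun l => by
    rw [Finset.sum_comm]
    exact Finset.sum_congr rfl fun c _ => Finset.sum_comm
  simp only [h4]
  rw [Finset.sum_comm]
  exact Finset.sum_congr rfl fun c _ => Finset.sum_comm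

theorem sum_sumDecompositions [CharZero 𝕜] {E : C → C → Prop} {φ : C → Fin 2}
    (hE : ∀ a b, φ a ≠ φ b → (E a b ↔ φ a > φ b)) (u : C → 𝔤) (V : Type) [Fintype V] {R : ℕ}
    (hR : Fintype.card V < R) :
    ∑ n ∈ Finset.range R, ((n.factorial : 𝕜)⁻¹) • L.sumDecompositions E φ u (Fin n) V =
      L.coeff E u V := by
  simp only [sumDecompositions, Finset.smul_sum]
  rw [Finset.sum_comm, coeff]
  refine Finset.sum_congr rfl fun c _ => ?_
  rw [Finset.sum_comm, sumColored]
  refine Finset.sum_congr rfl fun r _ => ?_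
  by_cases hr : IsDs r
  swap
  · simp [opColored, L.opRel_eq_zero hr]
  rw [opColored]
  split_ifs with h
  -- There are `q!` decompositions, all with `q` blocks. As `q ≤ |V| < R`, the truncated sum
  -- contains this term.
  · obtain ⟨q, hq, hcard⟩ := IsDecomposition.card_eq hE hr h
    rw [Finset.sum_eq_single q]
    · rw [hcard, if_pos rfl, ← Nat.cast_smul_eq_nsmul 𝕜, smul_smul,
        inv_mul_cancel₀ (Nat.cast_ne_zero.mpr (Nat.factorial_ne_zero _)), one_smul]
    · intro n _ hn
      rw [hcard, if_neg hn, zero_smul, smul_zero]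
    · intro hq'
      exact absurd (Finset.mem_range.mpr (hq.trans_lt hR)) hq'
  · refine Finset.sum_eq_zero fun n _ => ?_
    have : IsEmpty {p : (V → Fin n) × (Fin n → Fin 2) // IsDecomposition E φ c r p.1 p.2} :=
      ⟨fun p => h (p.2.adj hE)⟩
    simp

theorem coeff_sub_sumLevels_mem [CharZero 𝕜] (E : C → C → Prop) (φ : C → Fin 2) {u : C → 𝔤}
    (hu : ∀ a, u a ∈ L.filt 1 0) {s : Fin 2 → 𝔤}
    (hs : ∀ d, L.HasSeries E (fun a => if φ a = d then u a else 0) (s d)) (n R : ℕ) :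
    L.coeff (fun a b : Fin 2 => a > b) s (Fin n) - ∑ N ∈ Finset.range R,
      ((N.factorial : 𝕜)⁻¹) • L.sumLevels E φ u (Fin n) (Fin N) ∈ L.filt R 0 := by
  simp only [sumLevels, Finset.smul_sum]
  rw [Finset.sum_comm, coeff, ← Finset.sum_sub_distrib]
  refine Submodule.sum_mem _ fun l _ => ?_
  rw [Finset.sum_comm, sumColored, ← Finset.sum_sub_distrib]
  refine Submodule.sum_mem _ fun g _ => ?_
  rw [opColored]
  split_ifs with h
  · refine L.opRel_sub_sumMaps_mem E g _ (fun b a => ?_) _ (fun b => hs _) R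
    split_ifs
    · exact hu a
    · exact Submodule.zero_mem _
  · simp

/-- The composition of series: if `φ` sorts the colours into two levels such that the edges
between different levels are exactly those that go down, then the product of the series of the
levels is the series of all graphs. -/
theorem HasSeries.comp [CharZero 𝕜] {E : C → C → Prop} {φ : C → Fin 2}
    (hE : ∀ a b, φ a ≠ φ b → (E a b ↔ φ a > φ b)) {u : C → 𝔤} (hu : ∀ a, u a ∈ L.filt 1 0)
    {s : Fin 2 → 𝔤} (hs : ∀ d, L.HasSeries E (fun a => if φ a = d then u a else 0) (s d)) {t : 𝔤}
    (ht : L.HasSeries (fun a b : Fin 2 => a > b) s t) : L.HasSeries E u t := by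
  intro R
  suffices h : L.partialSum (fun a b : Fin 2 => a > b) s R - L.partialSum E u R ∈ L.filt R 0 by
    simpa using Submodule.add_mem _ (ht R) h
  have h1 : L.partialSum E u R = ∑ n ∈ Finset.range R, ((n.factorial : 𝕜)⁻¹) •
      ∑ N ∈ Finset.range R, ((N.factorial : 𝕜)⁻¹) • L.sumLevels E φ u (Fin n) (Fin N) := by
    simp only [Finset.smul_sum]
    rw [Finset.sum_comm, partialSum]
    refine Finset.sum_congr rfl fun N hN => ?_
    rw [← L.sum_sumDecompositions hE u (Fin N) (R := R) (by simpa using hN), Finset.smul_sum]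
    refine Finset.sum_congr rfl fun n _ => ?_
    rw [L.sumLevels_eq_sumDecompositions E φ u (fun a => L.mem_filt_zero (hu a)), smul_comm]
  rw [h1, partialSum, ← Finset.sum_sub_distrib]
  refine Submodule.sum_mem _ fun n _ => ?_
  rw [← smul_sub]
  exact Submodule.smul_mem _ _ (L.coeff_sub_sumLevels_mem E φ hu hs n R)

end CompleteLieGraphAlgebra

/-! ### From isomorphism classes to labelled graphs -/

section Orbits

/-- Orbit-stabilizer: the orbit of `x` contributes `|G| / |Stab x|` equal terms. -/
theorem sum_quotient_eq {𝕜 M X G : Type*} [Field 𝕜] [CharZero 𝕜] [AddCommGroup M] [Module 𝕜 M]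
    [Fintype X] (S : Setoid X) [Fintype (Quotient S)] [Group G] [Finite G] [MulAction G X]
    (hS : ∀ x y, S x y ↔ ∃ g : G, g • x = y) (F : X → M) (hF : ∀ (g : G) x, F (g • x) = F x) :
    ∑ q : Quotient S, ((Nat.card (MulAction.stabilizer G q.out) : 𝕜)⁻¹) • F q.out =
      ((Nat.card G : 𝕜)⁻¹) • ∑ x, F x := by
  classical
  rw [← Finset.sum_fiberwise Finset.univ (fun x : X => (⟦x⟧ : Quotient S)) F, Finset.smul_sum]
  refine Finset.sum_congr rfl fun q _ => ?_
  have h1 : ∀ x, ⟦x⟧ = q ↔ x ∈ MulAction.orbit G q.out := by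
    intro x
    rw [← Quotient.out_eq q, Quotient.eq, Quotient.out_eq q]
    exact ⟨fun h => (hS _ _).mp (S.symm h), fun h => S.symm ((hS _ _).mpr h)⟩
  have h2 : ∑ x with (⟦x⟧ : Quotient S) = q, F x =
      (Nat.card (MulAction.orbit G q.out) : 𝕜) • F q.out := by
    rw [Finset.sum_congr rfl (g := fun _ => F q.out), Finset.sum_const, Nat.cast_smul_eq_nsmul]
    · congr 1
      rw [Nat.card_eq_fintype_card, Fintype.card_subtype]
      exact congrArg Finset.card (Finset.filter_congr fun x _ => h1 x)
    · intro x hx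
      obtain ⟨g, rfl⟩ := (h1 x).mp (Finset.mem_filter.mp hx).2
      exact hF g _
  have h3 : (Nat.card (MulAction.orbit G q.out) : 𝕜) * Nat.card (MulAction.stabilizer G q.out) =
      Nat.card G := by
    rw [← Nat.cast_mul, ← Nat.card_prod,
      Nat.card_congr (MulAction.orbitProdStabilizerEquivGroup G q.out)]
  have h4 : (Nat.card G : 𝕜) ≠ 0 := Nat.cast_ne_zero.mpr Nat.card_pos.ne'
  rw [h2, smul_smul, ← h3]
  congr 1
  rw [← h3] at h4
  rw [mul_inv_rev, inv_mul_cancel_right₀ (left_ne_zero_of_mul h4)]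

end Orbits

namespace DsGraph

variable {V : Type}

@[ext]
theorem ext {g h : DsGraph V} (H : ∀ a b, g.Adj a b ↔ h.Adj a b) : g = h :=
  toDigraph_injective V (by ext a b; exact H a b)

/-- The permutations of the vertices act on graphs. -/
instance : MulAction (Equiv.Perm V) (DsGraph V) where
  smul σ g := (g.isDs.comap σ⁻¹).graph
  one_smul _ := rfl
  mul_smul σ τ g := by
    ext a b
    change g.Adj ((σ * τ)⁻¹ a) ((σ * τ)⁻¹ b) ↔ g.Adj (τ⁻¹ (σ⁻¹ a)) (τ⁻¹ (σ⁻¹ b))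
    rw [mul_inv_rev]
    rfl

theorem smul_adj (σ : Equiv.Perm V) (g : DsGraph V) (a b : V) :
    (σ • g).Adj a b ↔ g.Adj (σ⁻¹ a) (σ⁻¹ b) := Iff.rfl

theorem smul_eq_iff (σ : Equiv.Perm V) (g h : DsGraph V) :
    σ • g = h ↔ ∀ a b, h.Adj (σ a) (σ b) ↔ g.Adj a b := by
  constructor
  · rintro rfl a b
    simp [smul_adj]
  · intro H
    ext a b
    rw [smul_adj, ← H]
    simp

/-- The stabilizer is the automorphism group. -/
def stabilizerEquiv (g : DsGraph V) : MulAction.stabilizer (Equiv.Perm V) g ≃ g.Aut where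
  toFun σ := ⟨σ.1, (smul_eq_iff _ _ _).mp σ.2 _ _⟩
  invFun e := ⟨e.toEquiv, (smul_eq_iff _ _ _).mpr fun _ _ => e.map_rel_iff⟩
  left_inv _ := rfl
  right_inv _ := rfl

end DsGraph

namespace LeveledGraph

variable {k : ℕ} {V : Type}

/-- The permutations of the vertices act on leveled graphs. -/
instance : MulAction (Equiv.Perm V) (LeveledGraph k V) where
  smul σ g := ⟨σ • g.toDsGraph, fun v => g.level (σ⁻¹ v), fun _ _ h => g.level_lt _ _ h⟩
  one_smul _ := rfl
  mul_smul σ τ g := by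
    apply toPair_injective
    refine Prod.ext (mul_smul σ τ g.toDsGraph) ?_
    funext v
    change g.level ((σ * τ)⁻¹ v) = g.level (τ⁻¹ (σ⁻¹ v))
    rw [mul_inv_rev]
    rfl

theorem smul_level (σ : Equiv.Perm V) (g : LeveledGraph k V) (v : V) :
    (σ • g).level v = g.level (σ⁻¹ v) := rfl

theorem smul_eq_iff (σ : Equiv.Perm V) (g h : LeveledGraph k V) :
    σ • g = h ↔ (∀ a b, h.Adj (σ a) (σ b) ↔ g.Adj a b) ∧ ∀ v, h.level (σ v) = g.level v := by
  constructor
  · rintro rfl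
    exact ⟨(DsGraph.smul_eq_iff _ _ _).mp rfl, fun v => by simp [smul_level]⟩
  · rintro ⟨h1, h2⟩
    apply toPair_injective
    refine Prod.ext ((DsGraph.smul_eq_iff _ _ _).mpr h1) ?_
    funext v
    change g.level (σ⁻¹ v) = h.level v
    rw [← h2]
    simp

/-- The stabilizer is the automorphism group. -/
def stabilizerEquiv (g : LeveledGraph k V) : MulAction.stabilizer (Equiv.Perm V) g ≃ g.Aut where
  toFun σ := ⟨⟨σ.1, ((smul_eq_iff _ _ _).mp σ.2).1 _ _⟩,
    ((smul_eq_iff _ _ _).mp σ.2).2⟩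
  invFun e := ⟨e.1.toEquiv, (smul_eq_iff _ _ _).mpr ⟨fun _ _ => e.1.map_rel_iff, e.2⟩⟩
  left_inv _ := rfl
  right_inv _ := rfl

end LeveledGraph

namespace CompleteLieGraphAlgebra

variable {𝕜 𝔤 : Type*} [Field 𝕜] [AddCommGroup 𝔤] [Module 𝕜 𝔤]
variable (L : CompleteLieGraphAlgebra 𝕜 𝔤)

variable {L} in
/-- The partial sums of a series that is graded by the number of vertices. -/
theorem HasFilteredSum.sub_sum_mem {Q : ℕ → Type} [∀ n, Fintype (Q n)] {f : (Σ n, Q n) → 𝔤} {s : 𝔤}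
    (hs : L.HasFilteredSum f s) (hf : ∀ i, f i ∈ L.filt i.1 0) (R : ℕ) :
    s - ∑ n ∈ Finset.range R, ∑ q : Q n, f ⟨n, q⟩ ∈ L.filt R 0 := by
  classical
  obtain ⟨S, hS⟩ := hs R
  let T : Finset (Σ n, Q n) := (Finset.range R).sigma fun _ => Finset.univ
  have h := hS (S ∪ T) Finset.subset_union_left
  rw [← Finset.sum_sdiff (Finset.subset_union_right : T ⊆ S ∪ T)] at h
  have h2 : ∑ i ∈ (S ∪ T) \ T, f i ∈ L.filt R 0 := by
    refine Submodule.sum_mem _ fun i hi => L.filt_le ?_ 0 (hf i)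
    have := (Finset.mem_sdiff.mp hi).2
    simpa [T] using this
  have h3 := Submodule.add_mem _ h h2
  rw [show ∑ n ∈ Finset.range R, ∑ q : Q n, f ⟨n, q⟩ = ∑ i ∈ T, f i from
    (Finset.sum_sigma _ _ _).symm]
  convert h3 using 1
  abel

theorem op_eq_opRel {n : ℕ} (g : DsGraph (Fin n)) {x : Fin n → 𝔤} (hx : ∀ v, x v ∈ L.filt 1 0) :
    L.op g x = L.opRel g.Adj x := (L.opRel_adj g x fun v => L.mem_filt_zero (hx v)).symm

theorem op_mem_filt {n : ℕ} (g : DsGraph (Fin n)) {x : Fin n → 𝔤} (hx : ∀ v, x v ∈ L.filt 1 0) :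
    L.op g x ∈ L.filt n 0 := by
  rw [L.op_eq_opRel g hx]
  simpa using L.opRel_mem_card g.Adj x hx

theorem op_smul {n : ℕ} (σ : Equiv.Perm (Fin n)) (g : DsGraph (Fin n)) {x : Fin n → 𝔤}
    (hx : ∀ v, x v ∈ L.filt 1 0) : L.op (σ • g) (fun v => x (σ⁻¹ v)) = L.op g x := by
  rw [L.op_eq_opRel g hx, L.op_eq_opRel _ fun v => hx _,
    L.opRel_equiv σ⁻¹ g.Adj x fun v => L.mem_filt_zero (hx v)]
  rfl

/-- Reindexing by any family that contains each allowed coloured directed simple graph exactly once;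
other relations contribute zero. -/
theorem coeff_eq_sum {C : Type} [Fintype C] (E : C → C → Prop) (u : C → 𝔤) (V : Type) [Fintype V]
    {ι : Type} [Fintype ι] (c : ι → V → C) (r : ι → V → V → Prop)
    (hinj : ∀ i j, c i = c j → r i = r j → i = j) (hE : ∀ i a b, r i a b → E (c i a) (c i b))
    (hsurj : ∀ c' r', IsDs r' → (∀ a b, r' a b → E (c' a) (c' b)) → ∃ i, c i = c' ∧ r i = r') :
    L.coeff E u V = ∑ i, L.opRel (r i) fun v => u (c i v) := by
  classical
  simp only [coeff, sumColored]
  rw [← Fintype.sum_prod_type']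
  symm
  refine Finset.sum_of_injOn (fun i => (c i, r i)) ?_ (fun _ _ => Finset.mem_univ _) ?_ ?_
  · intro i _ j _ h
    exact hinj i j (congrArg Prod.fst h) (congrArg Prod.snd h)
  · rintro ⟨c', r'⟩ _ h
    rw [opColored]
    split_ifs with hl
    · rw [L.opRel_eq_zero, zero_apply]
      intro hr
      obtain ⟨i, rfl, rfl⟩ := hsurj c' r' hr hl
      exact h ⟨i, Finset.mem_coe.mpr (Finset.mem_univ _), rfl⟩
    · rfl
  · intro i _
    rw [opColored, if_pos (hE i)]

theorem coeff_leveled {k : ℕ} {u : Fin k → 𝔤} (hu : ∀ a, u a ∈ L.filt 1 0) (n : ℕ)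
    [Fintype (LeveledGraph k (Fin n))] :
    L.coeff (fun a b : Fin k => a > b) u (Fin n) =
      ∑ g : LeveledGraph k (Fin n), L.op g.toDsGraph (fun v => u (g.level v)) := by
  simp only [L.op_eq_opRel _ fun v => hu _]
  refine L.coeff_eq_sum _ u (Fin n) (fun g : LeveledGraph k (Fin n) => g.level)
    (fun g => g.Adj) (fun g h h1 h2 => ?_) (fun g => g.level_lt) fun c r hr h =>
      ⟨⟨hr.graph, c, h⟩, rfl, rfl⟩
  apply LeveledGraph.toPair_injective
  exact Prod.ext (DsGraph.toDigraph_injective _ h2) h1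

theorem coeff_unit {x : 𝔤} (hx : x ∈ L.filt 1 0) (n : ℕ) [Fintype (DsGraph (Fin n))] :
    L.coeff (fun _ _ : Unit => True) (fun _ => x) (Fin n) =
      ∑ g : DsGraph (Fin n), L.op g (fun _ => x) := by
  simp only [L.op_eq_opRel _ fun v => hx]
  exact L.coeff_eq_sum _ _ (Fin n) (fun (_ : DsGraph (Fin n)) _ => ()) (fun g => g.Adj)
    (fun g h _ h2 => DsGraph.toDigraph_injective _ h2) (fun _ _ _ _ => trivial)
    fun c r hr _ => ⟨hr.graph, rfl, rfl⟩

theorem vec_mem {x y : 𝔤} (hx : x ∈ L.filt 1 0) (hy : y ∈ L.filt 1 0) (a : Fin 2) :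
    (![x, y] : Fin 2 → 𝔤) a ∈ L.filt 1 0 := by
  fin_cases a
  · exact hx
  · exact hy

theorem hasSeries_circ [CharZero 𝕜] (a b : L.GaugeElement) :
    L.HasSeries (fun a b : Fin 2 => a > b) ![(a.val : 𝔤), (b.val : 𝔤)] (L.circ a b).val := by
  intro R
  have := fun n => Fintype.ofFinite (LeveledGraph 2 (Fin n))
  have := fun n => Fintype.ofFinite (Quotient (LeveledGraph.isoSetoid 2 n))
  have hu := L.vec_mem a.val.2 b.val.2
  have h := (L.circ_spec a b).sub_sum_mem (Q := fun n => Quotient (LeveledGraph.isoSetoid 2 n))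
    (fun i => Submodule.smul_mem _ _ (L.op_mem_filt _ fun v => hu _)) R
  convert h using 2
  refine Finset.sum_congr rfl fun n _ => ?_
  rw [L.coeff_leveled hu n]
  have key := sum_quotient_eq (𝕜 := 𝕜) (LeveledGraph.isoSetoid 2 n) (G := Equiv.Perm (Fin n))
    (fun g h => ?_) (fun g => L.op g.toDsGraph
      (fun v => ![(a.val : 𝔤), (b.val : 𝔤)] (g.level v))) fun σ g => ?_
  · rw [Nat.card_perm, Nat.card_fin] at key
    rw [← key]
    refine Finset.sum_congr rfl fun q _ => ?_
    rw [Nat.card_congr (LeveledGraph.stabilizerEquiv q.out)]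
    rfl
  · constructor
    · rintro ⟨e, he⟩
      exact ⟨e.toEquiv, (LeveledGraph.smul_eq_iff _ _ _).mpr ⟨fun _ _ => e.map_rel_iff, he⟩⟩
    · rintro ⟨σ, hσ⟩
      obtain ⟨h1, h2⟩ := (LeveledGraph.smul_eq_iff _ _ _).mp hσ
      exact ⟨⟨σ, h1 _ _⟩, h2⟩
  · exact L.op_smul σ g.toDsGraph fun v => hu _

/-- The summands of the inverse of `𝟙 + x`. -/
def invTerm (x : 𝔤) (g : UnlabelledGraph) : 𝔤 :=
  ((-1 : 𝕜) ^ g.size / (Nat.card g.rep.Aut : 𝕜)) • L.act g x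

theorem invTerm_mem {x : 𝔤} (hx : x ∈ L.filt 1 0) (g : UnlabelledGraph) :
    L.invTerm x g ∈ L.filt g.size 0 :=
  Submodule.smul_mem _ _ (L.op_mem_filt _ fun _ => hx)

theorem exists_inv (x : L.filt 1 0) : ∃ s : L.filt 1 0, L.HasFilteredSum (L.invTerm (x : 𝔤)) s := by
  have hmem := L.invTerm_mem x.2
  have hpos : ∀ g : UnlabelledGraph, 1 ≤ g.size := by
    intro g
    obtain ⟨v⟩ := g.rep.connected.nonempty
    exact v.pos
  refine L.exists_hasFilteredSum _ (fun g => L.filt_antitone 0 (hpos g) (hmem g)) fun r => ?_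
  have hfin : (⋃ n ∈ Set.Iio r, Set.range
      (fun q : Quotient (DsGraph.isoSetoid n) => (⟨n, q⟩ : UnlabelledGraph))).Finite :=
    (Set.finite_Iio r).biUnion fun n _ => Set.finite_range _
  refine hfin.subset fun g hg => ?_
  have hlt : UnlabelledGraph.size g < r := by
    by_contra hle
    exact hg (L.filt_antitone 0 (not_lt.mp hle) (hmem g))
  exact Set.mem_biUnion (show g.1 ∈ Set.Iio r from hlt) ⟨g.2, rfl⟩

theorem hasSeries_inv [CharZero 𝕜] {x : 𝔤} (hx : x ∈ L.filt 1 0) {s : 𝔤}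
    (hs : L.HasFilteredSum (L.invTerm x) s) :
    L.HasSeries (fun _ _ : Unit => True) (fun _ => -x) s := by
  intro R
  have := fun n => Fintype.ofFinite (DsGraph (Fin n))
  have := fun n => Fintype.ofFinite (Quotient (DsGraph.isoSetoid n))
  have h := hs.sub_sum_mem (Q := fun n => Quotient (DsGraph.isoSetoid n)) (L.invTerm_mem hx) R
  convert h using 2
  refine Finset.sum_congr rfl fun n _ => ?_
  rw [L.coeff_unit (Submodule.neg_mem _ hx) n]
  have key := sum_quotient_eq (𝕜 := 𝕜) (DsGraph.isoSetoid n) (G := Equiv.Perm (Fin n))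
    (fun g h => ?_) (fun g => L.op g (fun _ => -x)) fun σ g => ?_
  · rw [Nat.card_perm, Nat.card_fin] at key
    rw [← key]
    refine Finset.sum_congr rfl fun q _ => ?_
    rw [Nat.card_congr (DsGraph.stabilizerEquiv q.out)]
    -- Multilinearity turns the `n` arguments `-x` into the sign `(-1) ^ n`.
    have : (fun _ : Fin n => -x) = fun _ : Fin n => (-1 : 𝕜) • x := by simp
    rw [this, MultilinearMap.map_smul_univ, Finset.prod_const, Finset.card_univ, Fintype.card_fin,
      smul_smul, mul_comm, ← div_eq_mul_inv]
    rfl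
  · constructor
    · rintro ⟨e⟩
      exact ⟨e.toEquiv, (DsGraph.smul_eq_iff _ _ _).mpr fun _ _ => e.map_rel_iff⟩
    · rintro ⟨σ, hσ⟩
      exact ⟨⟨σ, (DsGraph.smul_eq_iff _ _ _).mp hσ _ _⟩⟩
  · exact L.op_smul σ g fun _ => Submodule.neg_mem _ hx

end CompleteLieGraphAlgebra

/-! ### The group axioms and the inverse -/

/-- A directed simple graph on a finite set has a vertex without outgoing edges. -/
theorem IsDs.exists_sink {V : Type} [Finite V] {r : V → V → Prop} (h : IsDs r) :
    ∃ v, ∀ w, ¬ r v w := by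
  have : Std.Irrefl (flip (TransGen r)) := ⟨h.acyclic⟩
  have : IsTrans V (flip (TransGen r)) := ⟨fun _ _ _ h1 h2 => TransGen.trans h2 h1⟩
  have hwf : WellFounded (flip (TransGen r)) := Finite.wellFounded_of_trans_of_irrefl _
  obtain ⟨v⟩ := h.connected.nonempty
  obtain ⟨m, -, hm⟩ := hwf.has_min Set.univ ⟨v, trivial⟩
  exact ⟨m, fun w hw => hm w trivial (.single hw)⟩

theorem IsDs.subsingleton {V : Type} {r : V → V → Prop} (h : IsDs r) (hr : ∀ a b, ¬ r a b) :
    Subsingleton V := by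
  have : SimpleGraph.fromRel r = ⊥ := by
    ext a b
    simp [SimpleGraph.fromRel_adj, hr]
  exact SimpleGraph.preconnected_bot_iff_subsingleton.mp (this ▸ h.connected.preconnected)

namespace CompleteLieGraphAlgebra

variable {𝕜 𝔤 : Type*} [Field 𝕜] [AddCommGroup 𝔤] [Module 𝕜 𝔤]
variable (L : CompleteLieGraphAlgebra 𝕜 𝔤)

variable {L} in
/-- Colours that are labelled by zero can be dropped. -/
theorem HasSeries.extend {C D : Type} [Fintype C] [Fintype D] {E : C → C → Prop}
    {F : D → D → Prop} {u : C → 𝔤} {s : 𝔤} (hs : L.HasSeries E u s) (i : C → D)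
    (hi : Function.Injective i) (hE : ∀ a b, E a b ↔ F (i a) (i b)) {w : D → 𝔤}
    (hw : ∀ a, w (i a) = u a) (hw0 : ∀ b, (∀ a, i a ≠ b) → w b = 0) : L.HasSeries F w s := by
  classical
  have h : ∀ (V : Type) [Fintype V], L.coeff F w V = L.coeff E u V := by
    intro V _
    rw [coeff, coeff]
    symm
    refine Finset.sum_of_injOn (fun c v => i (c v)) ?_ (fun _ _ => Finset.mem_univ _) ?_ ?_
    · intro c _ c' _ h
      funext v
      exact hi (congrFun h v)
    · intro c _ hc
      obtain ⟨v, hv⟩ : ∃ v, ∀ a, i a ≠ c v := by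
        by_contra! hcon
        choose c' hc' using hcon
        exact hc ⟨c', Finset.mem_coe.mpr (Finset.mem_univ _), funext hc'⟩
      refine Finset.sum_eq_zero fun r _ => ?_
      rw [opColored, (L.opRel r).map_coord_zero v (hw0 _ hv), ite_self]
    · intro c _
      simp only [sumColored, opColored, hw, hE]
  intro R
  have := hs R
  rwa [partialSum, Finset.sum_congr rfl fun N _ => by rw [← h (Fin N)]] at this

theorem coeff_point {x : 𝔤} (hx : x ∈ L.filt 1 0) (n : ℕ) :
    L.coeff (fun _ _ : Unit => False) (fun _ => x) (Fin n) = if n = 1 then x else 0 := by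
  split_ifs with hn
  · subst hn
    have hbot : ∀ v : Fin 1, ¬ (fun _ _ : Fin 1 => False) v v := fun _ h => h
    rw [L.coeff_eq_sum _ _ (Fin 1) (fun (_ : Unit) _ => ()) (fun _ _ _ => False)
      (fun _ _ _ _ => rfl) (fun _ _ _ h => h.elim)
      fun c r _ h => ⟨(), rfl, by ext a b; exact ⟨False.elim, h a b⟩⟩]
    rw [Fintype.sum_unique, L.opRel_unique hbot _ fun _ => L.mem_filt_zero hx]
  · rw [L.coeff_eq_sum _ _ (Fin n) (ι := Empty) (fun i => i.elim) (fun i => i.elim)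
      (fun i => i.elim) (fun i => i.elim)]
    · rfl
    · intro c r hr h
      have h1 := hr.subsingleton h
      obtain ⟨v⟩ := hr.connected.nonempty
      have := Fintype.card_eq_one_iff_nonempty_unique.mpr ⟨⟨⟨v⟩, fun w => h1.elim w v⟩⟩
      exact absurd (by simpa using this) hn

theorem hasSeries_point {x : 𝔤} (hx : x ∈ L.filt 1 0) :
    L.HasSeries (fun _ _ : Unit => False) (fun _ => x) x := by
  intro R
  simp only [partialSum, L.coeff_point hx, smul_ite, smul_zero, Finset.sum_ite_eq',
    Finset.mem_range]
  split_ifs with h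
  · simp
  · rw [sub_zero]
    exact L.filt_le (not_lt.mp h) 0 hx

/-- Sign-reversing involution: for a fixed graph, change the colour of one chosen sink. Only sources
of edges are constrained, so admissibility is preserved, while the label changes from `x` to `-x` or
back. The coefficients therefore vanish on every vertex set. -/
theorem hasSeries_sink {x : 𝔤} :
    L.HasSeries (fun a _ : Fin 2 => a = 1) ![x, -x] 0 := by
  classical
  have h : ∀ (V : Type) [Fintype V],
      L.coeff (fun a _ : Fin 2 => a = 1) ![x, -x] V = 0 := by
    intro V _
    simp only [coeff, sumColored]
    rw [Finset.sum_comm]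
    refine Finset.sum_eq_zero fun r _ => ?_
    by_cases hr : IsDs r
    swap
    · simp [opColored, L.opRel_eq_zero hr]
    obtain ⟨v, hv⟩ := hr.exists_sink
    have hflip : ∀ a : Fin 2, a.rev ≠ a := by decide
    refine Finset.sum_ninvolution (fun c => Function.update c v (c v).rev) (fun c => ?_)
      (fun c _ h => hflip (c v) (by simpa using congrFun h v)) (fun _ => Finset.mem_univ _)
      fun c => by simp
    have hcond : (∀ a b, r a b → Function.update c v (c v).rev a = 1) ↔ ∀ a b, r a b → c a = 1 := by
      refine forall_congr' fun a => forall_congr' fun b => imp_congr_right fun hab => ?_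
      rw [Function.update_of_ne]
      rintro rfl
      exact hv b hab
    have harg : (fun w => (![x, -x] : Fin 2 → 𝔤) (Function.update c v (c v).rev w)) =
        Function.update (fun w => (![x, -x] : Fin 2 → 𝔤) (c w)) v (-![x, -x] (c v)) := by
      funext w
      by_cases hw : w = v
      · subst hw
        simp only [Function.update_self]
        generalize c w = a
        fin_cases a <;> simp
      · simp [Function.update_of_ne hw]
    rw [opColored, opColored, harg, MultilinearMap.map_update_neg, Function.update_eq_self]
    by_cases hc : ∀ a b, r a b → c a = 1
    · rw [if_pos hc, if_pos (hcond.mpr hc), add_neg_cancel]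
    · rw [if_neg hc, if_neg (hcond.not.mpr hc), add_zero]
  intro R
  simp [partialSum, h]

/-- The inverse `𝟙 + ∑ (-1)^|g| g(x) / |Aut g|` of `𝟙 + x`. -/
def gaugeInv (a : L.GaugeElement) : L.GaugeElement := ⟨(L.exists_inv a.val).choose⟩

theorem gaugeInv_spec (a : L.GaugeElement) :
    L.HasFilteredSum (L.invTerm (a.val : 𝔤)) (L.gaugeInv a).val :=
  (L.exists_inv a.val).choose_spec

variable [CharZero 𝕜]

theorem circ_val_eq_of_hasSeries {C : Type} [Fintype C] {E : C → C → Prop} {φ : C → Fin 2}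
    (hE : ∀ a b, φ a ≠ φ b → (E a b ↔ φ a > φ b)) {u : C → 𝔤} (hu : ∀ a, u a ∈ L.filt 1 0)
    {a b : L.GaugeElement} (ha : L.HasSeries E (fun c => if φ c = 0 then u c else 0) a.val)
    (hb : L.HasSeries E (fun c => if φ c = 1 then u c else 0) b.val) :
    L.HasSeries E u (L.circ a b).val :=
  HasSeries.comp L hE hu (s := ![(a.val : 𝔤), (b.val : 𝔤)])
    (fun d => by fin_cases d <;> assumption) (L.hasSeries_circ a b)

theorem circ_assoc (a b c : L.GaugeElement) :
    L.circ (L.circ a b) c = L.circ a (L.circ b c) := by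
  have hu : ∀ i, (![(a.val : 𝔤), (b.val : 𝔤), (c.val : 𝔤)] : Fin 3 → 𝔤) i ∈ L.filt 1 0 := by
    intro i
    fin_cases i
    · exact a.val.2
    · exact b.val.2
    · exact c.val.2
  -- Only the sorting of the three levels into two differs between the bracketings.
  refine GaugeElement.ext (Subtype.ext (HasSeries.unique
    (L.circ_val_eq_of_hasSeries (E := fun i j : Fin 3 => i > j) (φ := ![0, 0, 1]) (by decide) hu
      ?_ ?_)
    (L.circ_val_eq_of_hasSeries (E := fun i j : Fin 3 => i > j) (φ := ![0, 1, 1]) (by decide) hu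
      ?_ ?_)))
  · refine (L.hasSeries_circ a b).extend ![0, 1] (by decide) (by decide) ?_ ?_
    · intro i; fin_cases i <;> simp
    · intro i; fin_cases i <;> simp [Fin.forall_fin_two]
  · refine (L.hasSeries_point c.val.2).extend (fun _ => 2) (by decide) (by decide) ?_ ?_
    · intro i; simp
    · intro i; fin_cases i <;> simp
  · refine (L.hasSeries_point a.val.2).extend (fun _ => 0) (by decide) (by decide) ?_ ?_
    · intro i; simp
    · intro i; fin_cases i <;> simp
  · refine (L.hasSeries_circ b c).extend ![1, 2] (by decide) (by decide) ?_ ?_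
    · intro i; fin_cases i <;> simp
    · intro i; fin_cases i <;> simp [Fin.forall_fin_two]

theorem circ_unit (a : L.GaugeElement) : L.circ a L.unit = a := by
  refine GaugeElement.ext (Subtype.ext (HasSeries.unique (L.hasSeries_circ a L.unit) ?_))
  -- The upper colour carries zero and is dropped. The remaining level has no inner edges, so only
  -- the one-vertex graph is left.
  refine (L.hasSeries_point a.val.2).extend (fun _ => 0) (by decide) (by decide) ?_ ?_
  · intro i; simp
  · intro i; fin_cases i <;> simp [unit]

theorem circ_gaugeInv (a : L.GaugeElement) : L.circ a (L.gaugeInv a) = L.unit := by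
  refine GaugeElement.ext (Subtype.ext (HasSeries.unique
    (L.circ_val_eq_of_hasSeries (E := fun i _ : Fin 2 => i = 1) (φ := id) (by decide)
      (L.vec_mem a.val.2 (Submodule.neg_mem _ a.val.2)) ?_ ?_) L.hasSeries_sink))
  · refine (L.hasSeries_point a.val.2).extend (fun _ => 0) (by decide) (by decide) ?_ ?_
    · intro i; simp
    · intro i; fin_cases i <;> simp
  · refine (L.hasSeries_inv a.val.2 (L.gaugeInv_spec a)).extend (fun _ => 1) (by decide)
      (by decide) ?_ ?_
    · intro i; simp
    · intro i; fin_cases i <;> simp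

end CompleteLieGraphAlgebra

end

theorem mainTheorem6 {𝕜 𝔤 : Type*} [Field 𝕜] [CharZero 𝕜] [AddCommGroup 𝔤] [Module 𝕜 𝔤]
    (L : CompleteLieGraphAlgebra 𝕜 𝔤) :
    ∃ _ : Group L.GaugeElement,
      (1 : L.GaugeElement) = L.unit ∧
      (∀ a b : L.GaugeElement, a * b = L.circ a b) ∧
      ∀ x : L.filt 1 0,
        L.HasFilteredSum
          (fun g : UnlabelledGraph =>
            ((-1 : 𝕜) ^ g.size / (Nat.card g.rep.Aut : 𝕜)) • L.act g (x : 𝔤))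
          (((CompleteLieGraphAlgebra.GaugeElement.onePlus x : L.GaugeElement)⁻¹).val : 𝔤) := by
  let : Mul L.GaugeElement := ⟨L.circ⟩
  let : One L.GaugeElement := ⟨L.unit⟩
  let : Inv L.GaugeElement := ⟨L.gaugeInv⟩
  -- Associativity, a right unit and right inverses suffice. The inverse of the resulting group is
  -- `gaugeInv` by definition.
  exact ⟨Group.ofRightAxioms L.circ_assoc L.circ_unit L.circ_gaugeInv, rfl, fun _ _ => rfl,
    fun x => L.gaugeInv_spec ⟨x⟩⟩
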